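/- **Setting.** Let $M,N\ge 1$ be integers, $0<t<1$, and let $a_1,\dots,a_M>0$, $b_1,\dots,b_N>0$ satisfy $a_ib_j<1$ for all $i,j$. Let $0<Q<1$, $\xi_1,\dots,\xi_M>0$, $u_1,\dots,u_N>0$ with $\xi_xu_y>1/\sqrt Q$ for all $x,y$, and assume that the parameters are matched by $$t=Q,\qquad a_x=\frac{\sqrt t}{\xi_x}\ (1\le x\le M),\qquad b_y=\frac1{t\,u_y}\ (1\le y\le N).$$ **Partitions from sign strings.** To a string $T\in\{+,-\}^{M+N}$ with $M$ pluses and $N$ minuses associate the partition $\nu(T)$ whose Young diagram (rows left-justified, placed in the $M\times N$ box with $M$ rows and $N$ columns) lies to the north-west of the path that starts at the lower left corner of the box and makes, reading $T$ from left to right, a step up for each $+$ and a step right for each $-$. **Hall–Littlewood process.** Write $m_i(\lambda)$ for the number of parts of $\lambda$ equal to $i$, $\lambda_1'$ for its number of parts, and $\mu\prec\lambda$ if $\lambda_1\ge\mu_1\ge\lambda_2\ge\mu_2\ge\cdots$. The one-variable skew Hall–Littlewood polynomials are $$P_{\lambda/\mu}(x)=x^{|\lambda|-|\mu|}\prod_{i\ge1:\,m_i(\mu)=m_i(\lambda)+1}\bigl(1-t^{m_i(\mu)}\bigr),\qquad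 Q_{\lambda/\mu}(x)=x^{|\lambda|-|\mu|}\prod_{i\ge1:\,m_i(\lambda)=m_i(\mu)+1}\bigl(1-t^{m_i(\lambda)}\bigr)$$ if $\mu\prec\lambda$, and both are $0$ otherwise. A sequence of partitions $\lambda^{(1)}\subset\cdots\subset\lambda^{(M)}\supset\cdots\supset\lambda^{(M+N-1)}$, with $\lambda^{(0)}=\lambda^{(M+N)}=\varnothing$, has probability $$\mathrm{Prob}_{M,N}=\prod_{i=1}^M\prod_{j=1}^N\frac{1-a_ib_j}{1-ta_ib_j}\;\prod_{i=1}^{M}P_{\lambda^{(i)}/\lambda^{(i-1)}}(a_i)\;\prod_{j=1}^{N}Q_{\lambda^{(M+j-1)}/\lambda^{(M+j)}}(b_{N-j+1}).$$ For a sequence whose neighbouring members interlace, let $T$ be the following string. For $1\le i\le M$, $T(i)=+$ if $(\lambda^{(i)})'_1=(\lambda^{(i-1)})'_1$ and $T(i)=-$ if $(\lambda^{(i)})'_1=(\lambda^{(i-1)})'_1+1$; for $M<i\le M+N$, $T(i)=+$ if $(\lambda^{(i-1)})'_1=(\lambda^{(i)})'_1+1$ and $T(i)=-$ if $(\lambda^{(i-1)})'_1=(\lambda^{(i)})'_1$.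 The *support* of the sequence is $[\lambda^{(1)}\subset\cdots\supset\lambda^{(M+N-1)}]:=\nu(T)$. The probability that the support equals $\nu$ is the sum of the probabilities of all sequences with support $\nu$. **Six vertex model.** Consider the lattice of vertices $(x,y)$, $1\le x\le M$, $1\le y\le N$, each with a left, bottom, right and top edge. A state $\sigma$ is a choice of occupied edges such that all left boundary edges are occupied, all bottom boundary edges are unoccupied, and at each vertex the number of occupied edges among left and bottom equals that among right and top. With $z=\xi_xu_y$, the weight of the vertex $(x,y)$ is $1$ if none or all of its edges are occupied, and otherwise, writing (occupied incoming edge → occupied outgoing edge), $$\text{left}\to\text{right}:\ \frac{\frac1Q-\frac{1}{\sqrt Q}z}{1-\frac1{\sqrt Q}z},\quad \text{left}\to\text{top}:\ \frac{1-\frac1Q}{1-\frac1{\sqrt Q}z},\quad \text{bottom}\to\text{top}:\ \frac{1-\sqrt Q\,z}{1-\frac1{\sqrt Q}z},\quad \text{bottom}\to\text{right}:\ \frac{(Q-1)\frac1{\sqrt Q}z}{1-\frac1{\sqrt Q}z}.$$ The probability $\mathrm{Prob}^{6V}_{M,N}(\sigma)$ is the product of all vertex weights. Number the $M+N$ outgoing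 edges from the top left to the bottom right corner (the top edges of $(1,N),\dots,(M,N)$, then the right edges of $(M,N),\dots,(M,1)$), let $T(i)=+$ if edge $i$ is unoccupied and $T(i)=-$ if it is occupied, and put $\mathcal O(\sigma)=\nu(T)$. The probability that $\mathcal O(\sigma)=\nu$ is the sum of the probabilities of all states with $\mathcal O(\sigma)=\nu$. **Theorem.** For every partition $\nu$ whose Young diagram is contained in the $M\times N$ rectangle, the series defining the left-hand side below converges, and $$\mathrm{Prob}_{M,N}\bigl([\lambda^{(1)}\subset\cdots\subset\lambda^{(M)}\supset\cdots\supset\lambda^{(M+N-1)}]=\nu\bigr)=\mathrm{Prob}^{6V}_{M,N}\bigl(\mathcal O(\sigma)=\nu\bigr).$$ -/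

import Mathlib

open scoped Finset

namespace HLSixVertex

/-! ### One-variable skew Hall--Littlewood polynomials.
Partitions are Young diagrams; `lam.rowLen i` is the part with (zero-based) index `i`,
`lam.colLen 0` is the number of positive parts. -/

/-- `m_i(lam)`, the number of parts of `lam` that are equal to `i ≥ 1`. -/
def mult (lam : YoungDiagram) (i : ℕ) : ℕ := lam.rowLens.count i

/-- `mu ≺ lam`: `lam₁ ≥ mu₁ ≥ lam₂ ≥ mu₂ ≥ ⋯`. -/
def Interlaces (mu lam : YoungDiagram) : Prop :=
  ∀ i : ℕ, mu.rowLen i ≤ lam.rowLen i ∧ lam.rowLen (i + 1) ≤ mu.rowLen i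

open Classical in
/-- `P_{lam/mu}(x; t)` in one variable `x`. The product runs over all `i ≥ 1` with
`m_i(mu) = m_i(lam) + 1`; such an `i` is at most the largest part of `mu`. -/
noncomputable def skewP (t : ℝ) (lam mu : YoungDiagram) (x : ℝ) : ℝ :=
  if Interlaces mu lam then
    x ^ (lam.card - mu.card) *
      ∏ i ∈ Finset.Icc 1 (mu.rowLen 0) with mult lam i + 1 = mult mu i, (1 - t ^ mult mu i)
  else 0

open Classical in
/-- `Q_{lam/mu}(x; t)` in one variable `x`. The product runs over all `i ≥ 1` with
`m_i(lam) = m_i(mu) + 1`; such an `i` is at most the largest part of `lam`. -/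
noncomputable def skewQ (t : ℝ) (lam mu : YoungDiagram) (x : ℝ) : ℝ :=
  if Interlaces mu lam then
    x ^ (lam.card - mu.card) *
      ∏ i ∈ Finset.Icc 1 (lam.rowLen 0) with mult lam i = mult mu i + 1, (1 - t ^ mult lam i)
  else 0

/-! ### Sign strings and partitions -/

/-- The partition `ν(T)` of a sign string `T` (`true` is `+`, `false` is `-`). Read `T` from left
to right as a lattice path, `+` being a step up and `-` a step to the right; the path is the
south-east boundary of the diagram. The up step `k` bounds on the right the row that has as many
rows above it as there are pluses after `k`, and the length of this row is the number of minuses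
before `k`. The diagram consists of the cells to the north-west of an up step. -/
def partitionOfString {L : ℕ} (T : Fin L → Bool) : YoungDiagram where
  cells := {c ∈ Finset.range L ×ˢ Finset.range L | ∃ k : Fin L, T k = true ∧
    c.1 ≤ #{l : Fin L | k < l ∧ T l = true} ∧ c.2 < #{l : Fin L | l < k ∧ T l = false}}
  isLowerSet := by
    rintro ⟨r, c⟩ ⟨r', c'⟩ hle h
    obtain ⟨hr, hc⟩ : r' ≤ r ∧ c' ≤ c := hle
    simp only [Finset.coe_filter, Finset.mem_product, Finset.mem_range, Set.mem_ofPred_eq] at h ⊢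
    obtain ⟨⟨h1, h2⟩, k, hk, h3, h4⟩ := h
    exact ⟨⟨by omega, by omega⟩, k, hk, by omega, by omega⟩

/-! ### The Hall--Littlewood process `∅ ⊂ lam⁽¹⁾ ⊂ ⋯ ⊂ lam⁽ᴹ⁾ ⊃ ⋯ ⊃ lam⁽ᴹ⁺ᴺ⁻¹⁾ ⊃ ∅` -/

/-- A sequence `lam⁽¹⁾, …, lam⁽ᴹ⁺ᴺ⁻¹⁾` of partitions; `lam⁽ᵏ⁾` has the index `k - 1`. -/
abbrev PartitionSeq (M N : ℕ) : Type := Fin (M + N - 1) → YoungDiagram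

/-- `lam⁽ᵏ⁾`, with the convention `lam⁽⁰⁾ = lam⁽ᴹ⁺ᴺ⁾ = ∅`. -/
def PartitionSeq.at {M N : ℕ} (lam : PartitionSeq M N) (k : ℕ) : YoungDiagram :=
  if h : 1 ≤ k ∧ k < M + N then lam ⟨k - 1, by omega⟩ else ⊥

/-- The probability of the sequence `lam`. The parameters `a₁, …, a_M` and `b₁, …, b_N` are
`a 0, …, a (M - 1)` and `b 0, …, b (N - 1)`. -/
noncomputable def processProb {M N : ℕ} (t : ℝ) (a : Fin M → ℝ) (b : Fin N → ℝ)
    (lam : PartitionSeq M N) : ℝ :=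
  ((∏ i : Fin M, skewP t (lam.at (i + 1)) (lam.at i) (a i)) *
    ∏ j : Fin N, skewQ t (lam.at (M + j)) (lam.at (M + j + 1)) (b j.rev)) /
    ∏ i : Fin M, ∏ j : Fin N, (1 - t * a i * b j) / (1 - a i * b j)

/-- The sign string `T` of a sequence: at an ascending step it is `+` when the number of parts is
unchanged (and `-` when it grows by one), at a descending step it is `+` when the number
of parts drops by one (and `-` when it is unchanged). On a sequence with interlacing neighbours
there are no other cases; all other sequences have probability `0`. -/
def supportString {M N : ℕ} (lam : PartitionSeq M N) : Fin (M + N) → Bool :=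
  Fin.append
    (fun i : Fin M => decide ((lam.at i).colLen 0 = (lam.at (i + 1)).colLen 0))
    (fun j : Fin N => decide ((lam.at (M + j)).colLen 0 = (lam.at (M + j + 1)).colLen 0 + 1))

/-- The support `[lam⁽¹⁾ ⊂ ⋯ ⊂ lam⁽ᴹ⁾ ⊃ ⋯ ⊃ lam⁽ᴹ⁺ᴺ⁻¹⁾]`. -/
def support {M N : ℕ} (lam : PartitionSeq M N) : YoungDiagram :=
  partitionOfString (supportString lam)

open Classical in
/-- The summand of `supportProb`. -/
noncomputable def supportTerm {M N : ℕ} (t : ℝ) (a : Fin M → ℝ) (b : Fin N → ℝ)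
    (ν : YoungDiagram) (lam : PartitionSeq M N) : ℝ :=
  if support lam = ν then processProb t a b lam else 0

/-- The probability that the support of the Hall--Littlewood process is `ν` (a sum over countably
many sequences). -/
noncomputable def supportProb {M N : ℕ} (t : ℝ) (a : Fin M → ℝ) (b : Fin N → ℝ)
    (ν : YoungDiagram) : ℝ :=
  ∑' lam : PartitionSeq M N, supportTerm t a b ν lam

/-! ### The stochastic six vertex model on the `M × N` lattice -/

/-- The probability weight of a vertex with parameter `z = ξ_x u_y`, depending on whether its
left, bottom, right and top edges (in this order) are occupied; it is `0` if the vertex is of none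
of the six types. -/
noncomputable def vertexWeight (Q z : ℝ) : Bool → Bool → Bool → Bool → ℝ
  | false, false, false, false => 1
  | true, true, true, true => 1
  | true, false, true, false => (1 / Q - 1 / √Q * z) / (1 - 1 / √Q * z)
  | true, false, false, true => (1 - 1 / Q) / (1 - 1 / √Q * z)
  | false, true, false, true => (1 - √Q * z) / (1 - 1 / √Q * z)
  | false, true, true, false => ((Q - 1) * (1 / √Q) * z) / (1 - 1 / √Q * z)
  | _, _, _, _ => 0

/-- An assignment of occupied/unoccupied to the edges of the `M × N` lattice. With zero-based
coordinates, the vertex `(x, y)` has the left edge `horiz x.castSucc y`, the right edge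
`horiz x.succ y`, the bottom edge `vert x y.castSucc` and the top edge `vert x y.succ`. -/
@[ext]
structure EdgeConfig (M N : ℕ) where
  horiz : Fin (M + 1) → Fin N → Bool
  vert : Fin M → Fin (N + 1) → Bool

/-- Edge configurations are pairs of functions on finite sets, hence finitely many. -/
def EdgeConfig.equiv (M N : ℕ) :
    ((Fin (M + 1) → Fin N → Bool) × (Fin M → Fin (N + 1) → Bool)) ≃ EdgeConfig M N where
  toFun p := ⟨p.1, p.2⟩
  invFun σ := (σ.horiz, σ.vert)
  left_inv _ := rfl
  right_inv _ := rfl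

instance (M N : ℕ) : Fintype (EdgeConfig M N) := Fintype.ofEquiv _ (EdgeConfig.equiv M N)

/-- A path enters along each left boundary edge and none along the bottom boundary edges. -/
def EdgeConfig.Boundary {M N : ℕ} (σ : EdgeConfig M N) : Prop :=
  (∀ y, σ.horiz 0 y = true) ∧ ∀ x, σ.vert x 0 = false

open Classical in
/-- The probability of a configuration: the product of its vertex weights if it satisfies
the boundary condition. -/
noncomputable def EdgeConfig.prob {M N : ℕ} (Q : ℝ) (ξ : Fin M → ℝ) (u : Fin N → ℝ)
    (σ : EdgeConfig M N) : ℝ :=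
  if σ.Boundary then
    ∏ x : Fin M, ∏ y : Fin N, vertexWeight Q (ξ x * u y)
      (σ.horiz x.castSucc y) (σ.vert x y.castSucc) (σ.horiz x.succ y) (σ.vert x y.succ)
  else 0

/-- The sign string of the outgoing edges, numbered from the top left corner (top edges from left
to right) to the bottom right corner (right edges from top to bottom): `+` is unoccupied and
`-` is occupied. -/
def EdgeConfig.outgoing {M N : ℕ} (σ : EdgeConfig M N) : Fin (M + N) → Bool :=
  Fin.append (fun x : Fin M => !σ.vert x (Fin.last N))
    (fun j : Fin N => !σ.horiz (Fin.last M) j.rev)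

open Classical in
/-- The probability that the outgoing edges encode `ν`. -/
noncomputable def outgoingProb {M N : ℕ} (Q : ℝ) (ξ : Fin M → ℝ) (u : Fin N → ℝ)
    (ν : YoungDiagram) : ℝ :=
  ∑ σ : EdgeConfig M N, if partitionOfString σ.outgoing = ν then σ.prob Q ξ u else 0

end HLSixVertex

namespace HLSixVertex

/-! ### Removing and adding a first column -/

/-! The equality already holds for each sign string `T`, before strings are grouped by their
partition. With all signs prescribed, the unnormalized weights of the process sum to a matrix
element between `⊥` and `⊥` of a product of kernels on Young diagrams: `M` ascending steps, each
with a bit `v` (the number of parts grows), followed by `N` descending steps, each with a bit `h`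
(the number of parts does not drop).

The heart of the proof is a local exchange relation (`exists_hasSum_valleyTerm_peakTerm`): an
ascending step followed by a descending one, with bits `v` and `h`, is a combination of
descending-then-ascending pairs, with coefficients `exchCoef`. If the old bits are read as the top
and right edges of a vertex and the new ones as its bottom and left edges, the coefficients are six
vertex weights times `(1 - t * w) / (1 - w)`, where `w = a * b` (`vertexWeight_mul`). When every
ascending step has been moved past every descending one, each pair `(x, y)` has contributed one
vertex. The descending steps now start at `⊥`, so none of them can lose a part: all left edges are
occupied. The ascending steps end at `⊥`, so none of them can gain one: all bottom edges are empty.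
What remains is the six vertex partition function (`upSteps_downSteps_bot`,
`transferSum_eq_sum_edgeConfig`), and the factors `(1 - t * w) / (1 - w)` multiply to the
normalization of the process.

The exchange relation is a refined skew Cauchy identity, proved by induction on the number of
columns. The skew polynomials factor over columns, each factor depending only on two adjacent
columns (`skewP_eq_colP_mul`, `skewQ_eq_colQ_mul`). Restoring a first column therefore acts on the
four bit pairs by a finite matrix, and these matrices intertwine the exchange coefficients
(`sum_colCoef_mul_exchCoef`). For empty diagrams the relation is a geometric series over one-row
diagrams. All weights are nonnegative, so compositions of kernels are computed in `ENNReal`, where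
sums may be interchanged freely; summability follows from the finiteness of the result. -/

theorem mem_image_pred_col {s : Finset (ℕ × ℕ)} {i j : ℕ} :
    (i, j) ∈ (s.filter fun c => 0 < c.2).image (fun c => (c.1, c.2 - 1)) ↔ (i, j + 1) ∈ s := by
  simp only [Finset.mem_image, Finset.mem_filter, Prod.exists, Prod.mk.injEq]
  constructor
  · rintro ⟨a, b, ⟨h, hb⟩, rfl, rfl⟩
    rwa [Nat.sub_add_cancel hb]
  · exact fun h => ⟨i, j + 1, ⟨h, j.succ_pos⟩, rfl, rfl⟩

/-- The diagram obtained by removing the first column. -/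
def dropCol (lam : YoungDiagram) : YoungDiagram where
  cells := (lam.cells.filter fun c => 0 < c.2).image (fun c => (c.1, c.2 - 1))
  isLowerSet := by
    rintro ⟨r, c⟩ ⟨r', c'⟩ hle h
    obtain ⟨hr, hc⟩ : r' ≤ r ∧ c' ≤ c := hle
    rw [Finset.mem_coe, mem_image_pred_col] at h ⊢
    exact lam.up_left_mem hr (by omega) h

theorem mem_dropCol {lam : YoungDiagram} {i j : ℕ} : (i, j) ∈ dropCol lam ↔ (i, j + 1) ∈ lam :=
  mem_image_pred_col

theorem nat_eq_of_forall_lt_iff {a b : ℕ} (h : ∀ i, i < a ↔ i < b) : a = b :=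
  le_antisymm (not_lt.1 fun hb => lt_irrefl b ((h b).1 hb))
    (not_lt.1 fun ha => lt_irrefl a ((h a).2 ha))

theorem colLen_dropCol (lam : YoungDiagram) (j : ℕ) :
    (dropCol lam).colLen j = lam.colLen (j + 1) :=
  nat_eq_of_forall_lt_iff fun i => by
    rw [← YoungDiagram.mem_iff_lt_colLen, ← YoungDiagram.mem_iff_lt_colLen, mem_dropCol]

theorem rowLen_dropCol (lam : YoungDiagram) (i : ℕ) :
    (dropCol lam).rowLen i = lam.rowLen i - 1 :=
  nat_eq_of_forall_lt_iff fun j => by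
    rw [← YoungDiagram.mem_iff_lt_rowLen, mem_dropCol, YoungDiagram.mem_iff_lt_rowLen]
    omega

/-- The shift of all cells by one column to the right. -/
def shiftCol : ℕ × ℕ ↪ ℕ × ℕ where
  toFun p := (p.1, p.2 + 1)
  inj' := by
    rintro ⟨a, b⟩ ⟨c, d⟩ h
    simpa using h

theorem shiftCol_apply (i j : ℕ) : shiftCol (i, j) = (i, j + 1) := rfl

/-- The diagram with first column of length `max c (lam.colLen 0)`, followed by the columns
of `lam`. -/
def consCol (c : ℕ) (lam : YoungDiagram) : YoungDiagram where
  cells := Finset.range (max c (lam.colLen 0)) ×ˢ {0} ∪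
    lam.cells.map shiftCol
  isLowerSet := by
    rintro ⟨r, c⟩ ⟨r', c'⟩ hle h
    obtain ⟨hr, hc⟩ : r' ≤ r ∧ c' ≤ c := hle
    simp only [Finset.coe_union, Finset.coe_product, Finset.coe_map, Set.mem_union, Set.mem_prod,
      Finset.mem_coe, Finset.mem_range, Finset.mem_singleton, Set.mem_image, Prod.exists,
      shiftCol_apply, Prod.mk.injEq, YoungDiagram.mem_cells] at h ⊢
    rcases h with ⟨h, rfl⟩ | ⟨i, j, h, rfl, rfl⟩
    · exact Or.inl ⟨by omega, by omega⟩
    · rcases c' with _ | c'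
      · refine Or.inl ⟨?_, rfl⟩
        have := YoungDiagram.mem_iff_lt_colLen.1 h
        have := lam.colLen_anti 0 j (Nat.zero_le _)
        omega
      · exact Or.inr ⟨r', c', lam.up_left_mem hr (by omega) h, rfl, rfl⟩

theorem mem_consCol_zero {c i : ℕ} {lam : YoungDiagram} :
    (i, 0) ∈ consCol c lam ↔ i < max c (lam.colLen 0) := by
  rw [← YoungDiagram.mem_cells, consCol]
  simp [shiftCol_apply]

theorem mem_consCol_succ {c i j : ℕ} {lam : YoungDiagram} :
    (i, j + 1) ∈ consCol c lam ↔ (i, j) ∈ lam := by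
  rw [← YoungDiagram.mem_cells, consCol]
  simp [shiftCol_apply]

theorem dropCol_consCol (c : ℕ) (lam : YoungDiagram) : dropCol (consCol c lam) = lam := by
  ext ⟨i, j⟩
  rw [YoungDiagram.mem_cells, YoungDiagram.mem_cells, mem_dropCol, mem_consCol_succ]

theorem colLen_consCol (c : ℕ) (lam : YoungDiagram) :
    (consCol c lam).colLen 0 = max c (lam.colLen 0) :=
  nat_eq_of_forall_lt_iff fun i => by
    rw [← YoungDiagram.mem_iff_lt_colLen, mem_consCol_zero]

theorem consCol_dropCol (lam : YoungDiagram) : consCol (lam.colLen 0) (dropCol lam) = lam := by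
  ext ⟨i, j⟩
  rw [YoungDiagram.mem_cells, YoungDiagram.mem_cells]
  rcases j with _ | j
  · rw [mem_consCol_zero, YoungDiagram.mem_iff_lt_colLen, colLen_dropCol,
      max_eq_left (lam.colLen_anti 0 1 (Nat.zero_le _))]
  · rw [mem_consCol_succ, mem_dropCol]

theorem card_eq_colLen_add (lam : YoungDiagram) :
    lam.card = lam.colLen 0 + (dropCol lam).card := by
  conv_lhs => rw [← consCol_dropCol lam]
  rw [YoungDiagram.card, consCol, Finset.card_union_of_disjoint, Finset.card_product,
    Finset.card_map, colLen_dropCol, max_eq_left (lam.colLen_anti 0 1 (Nat.zero_le _))]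
  · simp
  · rw [Finset.disjoint_left]
    rintro ⟨i, j⟩ h h'
    simp [shiftCol_apply] at h h'
    obtain ⟨_, _, _, _, h'⟩ := h'
    omega

theorem eq_bot_of_rowLen_eq_zero {lam : YoungDiagram} (h : lam.rowLen 0 = 0) : lam = ⊥ := by
  ext ⟨i, j⟩
  rw [YoungDiagram.mem_cells, YoungDiagram.mem_cells, YoungDiagram.mem_iff_lt_rowLen]
  have := lam.rowLen_anti 0 i (Nat.zero_le _)
  simp only [YoungDiagram.notMem_bot, iff_false]
  omega

theorem colLen_bot (j : ℕ) : (⊥ : YoungDiagram).colLen j = 0 :=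
  nat_eq_of_forall_lt_iff fun i => by simp [← YoungDiagram.mem_iff_lt_colLen]

theorem rowLen_bot (j : ℕ) : (⊥ : YoungDiagram).rowLen j = 0 :=
  nat_eq_of_forall_lt_iff fun i => by simp [← YoungDiagram.mem_iff_lt_rowLen]

theorem dropCol_bot : dropCol ⊥ = ⊥ :=
  eq_bot_of_rowLen_eq_zero (by rw [rowLen_dropCol, rowLen_bot])

theorem eq_bot_of_colLen_eq_zero {lam : YoungDiagram} (h : lam.colLen 0 = 0) : lam = ⊥ := by
  refine eq_bot_of_rowLen_eq_zero (Nat.eq_zero_of_not_pos fun h0 => ?_)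
  rw [← YoungDiagram.mem_iff_lt_rowLen, YoungDiagram.mem_iff_lt_colLen] at h0
  omega

/-! ### Interlacing and multiplicities in terms of columns -/

/-- Interlacing means that the skew diagram is a horizontal strip, with at most one cell in each
column. In this form the condition splits column by column. -/
theorem interlaces_iff_colLen {mu lam : YoungDiagram} :
    Interlaces mu lam ↔ ∀ j, mu.colLen j ≤ lam.colLen j ∧ lam.colLen j ≤ mu.colLen j + 1 := by
  constructor
  · intro h j
    constructor
    · by_contra! hlt
      rw [← YoungDiagram.mem_iff_lt_colLen, YoungDiagram.mem_iff_lt_rowLen] at hlt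
      have := YoungDiagram.mem_iff_lt_colLen.1
        (YoungDiagram.mem_iff_lt_rowLen.2 (hlt.trans_le (h (lam.colLen j)).1))
      omega
    · by_contra! hlt
      rw [← YoungDiagram.mem_iff_lt_colLen, YoungDiagram.mem_iff_lt_rowLen] at hlt
      have := YoungDiagram.mem_iff_lt_colLen.1
        (YoungDiagram.mem_iff_lt_rowLen.2 (hlt.trans_le (h (mu.colLen j)).2))
      omega
  · intro h i
    constructor
    · by_contra! hlt
      rw [← YoungDiagram.mem_iff_lt_rowLen, YoungDiagram.mem_iff_lt_colLen] at hlt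
      have := YoungDiagram.mem_iff_lt_rowLen.1
        (YoungDiagram.mem_iff_lt_colLen.2 (hlt.trans_le (h (lam.rowLen i)).1))
      omega
    · by_contra! hlt
      rw [← YoungDiagram.mem_iff_lt_rowLen, YoungDiagram.mem_iff_lt_colLen] at hlt
      have := YoungDiagram.mem_iff_lt_rowLen.1
        (YoungDiagram.mem_iff_lt_colLen.2
          (Nat.lt_of_succ_lt_succ (hlt.trans_le (h (mu.rowLen i)).2)))
      omega

theorem interlaces_iff_dropCol {mu lam : YoungDiagram} :
    Interlaces mu lam ↔ (mu.colLen 0 ≤ lam.colLen 0 ∧ lam.colLen 0 ≤ mu.colLen 0 + 1) ∧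
      Interlaces (dropCol mu) (dropCol lam) := by
  simp only [interlaces_iff_colLen, colLen_dropCol]
  exact ⟨fun h => ⟨h 0, fun j => h (j + 1)⟩, fun h j => by
    rcases j with _ | j
    exacts [h.1, h.2 j]⟩

theorem Interlaces.le {mu lam : YoungDiagram} (h : Interlaces mu lam) : mu ≤ lam := by
  rintro ⟨i, j⟩ hm
  have hm : (i, j) ∈ mu := hm
  have : (i, j) ∈ lam := by
    rw [YoungDiagram.mem_iff_lt_rowLen] at hm ⊢
    exact hm.trans_le (h i).1
  exact this

theorem Interlaces.card_le {mu lam : YoungDiagram} (h : Interlaces mu lam) : mu.card ≤ lam.card :=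
  Finset.card_le_card (YoungDiagram.cells_subset_iff.2 h.le)

theorem mult_add_one (lam : YoungDiagram) (j : ℕ) :
    mult lam (j + 1) = lam.colLen j - lam.colLen (j + 1) := by
  have key : (Finset.range (lam.colLen 0)).filter (fun r => lam.rowLen r = j + 1) =
      Finset.Ico (lam.colLen (j + 1)) (lam.colLen j) := by
    ext r
    have h0 := lam.colLen_anti 0 j (Nat.zero_le _)
    have h1 : r < lam.colLen j ↔ j < lam.rowLen r := by
      rw [← YoungDiagram.mem_iff_lt_colLen, YoungDiagram.mem_iff_lt_rowLen]
    have h2 : r < lam.colLen (j + 1) ↔ j + 1 < lam.rowLen r := by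
      rw [← YoungDiagram.mem_iff_lt_colLen, YoungDiagram.mem_iff_lt_rowLen]
    simp only [Finset.mem_filter, Finset.mem_range, Finset.mem_Ico]
    omega
  rw [← Nat.card_Ico, ← key, mult, YoungDiagram.rowLens, List.count_eq_countP, List.countP_map,
    List.countP_eq_length_filter, Finset.card_def]
  rfl

theorem mult_dropCol (lam : YoungDiagram) (j : ℕ) :
    mult (dropCol lam) (j + 1) = mult lam (j + 2) := by
  rw [mult_add_one, mult_add_one, colLen_dropCol, colLen_dropCol]

/-! ### Factorization of the skew polynomials over columns -/

/-- The factor of `skewP` contributed by the first column, in terms of the lengths of the first two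
columns of both diagrams. -/
noncomputable def colP (t x : ℝ) (l0 l1 m0 m1 : ℕ) : ℝ :=
  if m0 ≤ l0 ∧ l0 ≤ m0 + 1 then
    x ^ (l0 - m0) * (if l0 + 1 + m1 = m0 + l1 then 1 - t ^ (m0 - m1) else 1)
  else 0

/-- The factor of `skewQ` contributed by the first column. -/
noncomputable def colQ (t x : ℝ) (l0 l1 m0 m1 : ℕ) : ℝ :=
  if m0 ≤ l0 ∧ l0 ≤ m0 + 1 then
    x ^ (l0 - m0) * (if l0 + m1 = m0 + l1 + 1 then 1 - t ^ (l0 - l1) else 1)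
  else 0

/-- For the empty diagram the left product is empty while `f 1` still stands on the right; the
hypothesis `h` covers this case. -/
theorem prod_Icc_rowLen_dropCol (lam : YoungDiagram) (f : ℕ → ℝ) (h : lam.colLen 0 = 0 → f 1 = 1) :
    ∏ i ∈ Finset.Icc 1 (lam.rowLen 0), f i =
      f 1 * ∏ i ∈ Finset.Icc 1 ((dropCol lam).rowLen 0), f (i + 1) := by
  have hI : ∀ n (g : ℕ → ℝ), ∏ i ∈ Finset.Icc 1 n, g i = ∏ i ∈ Finset.range n, g (i + 1) := by
    intro n g
    rw [← Finset.prod_image (s := Finset.range n) (g := fun i => i + 1) (f := g)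
      (fun a _ b _ hab => by simpa using hab)]
    congr 1
    ext i
    simp only [Finset.mem_Icc, Finset.mem_image, Finset.mem_range]
    exact ⟨fun hi => ⟨i - 1, by omega, by omega⟩, fun ⟨j, hj, hi⟩ => by omega⟩
  rw [hI, hI, rowLen_dropCol]
  rcases Nat.eq_zero_or_pos (lam.rowLen 0) with h0 | h0
  · rw [h0, h (by rw [eq_bot_of_rowLen_eq_zero h0, colLen_bot])]
    simp
  · obtain ⟨n, hn⟩ : ∃ n, lam.rowLen 0 = n + 1 := ⟨lam.rowLen 0 - 1, by omega⟩
    rw [hn, Finset.prod_range_succ', mul_comm]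
    rfl

theorem card_sub_card_dropCol {lam mu : YoungDiagram} (h : Interlaces mu lam) :
    lam.card - mu.card = (lam.colLen 0 - mu.colLen 0) +
      ((dropCol lam).card - (dropCol mu).card) := by
  have h1 := card_eq_colLen_add lam
  have h2 := card_eq_colLen_add mu
  have h3 := interlaces_iff_dropCol.1 h
  have h4 := h3.2.card_le
  omega

theorem skewP_eq_colP_mul (t x : ℝ) (lam mu : YoungDiagram) :
    skewP t lam mu x =
      colP t x (lam.colLen 0) (lam.colLen 1) (mu.colLen 0) (mu.colLen 1) *
        skewP t (dropCol lam) (dropCol mu) x := by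
  have hl := lam.colLen_anti 0 1 (Nat.zero_le _)
  have hm := mu.colLen_anti 0 1 (Nat.zero_le _)
  by_cases h : Interlaces mu lam
  · have h' := interlaces_iff_dropCol.1 h
    simp only [skewP, colP]
    rw [if_pos h, if_pos h'.1, if_pos h'.2, card_sub_card_dropCol h, Finset.prod_filter,
      Finset.prod_filter, prod_Icc_rowLen_dropCol, pow_add]
    -- The condition in `colP` is the multiplicity condition at part size 1, cleared of truncated
    -- subtraction; the columns are weakly decreasing, so both agree.
    · have e : (lam.colLen 0 + 1 + mu.colLen 1 = mu.colLen 0 + lam.colLen 1) ↔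
          mult lam 1 + 1 = mult mu 1 := by
        rw [mult_add_one lam 0, mult_add_one mu 0, Nat.zero_add]
        omega
      have e2 : ∏ i ∈ Finset.Icc 1 ((dropCol mu).rowLen 0),
          (if mult (dropCol lam) i + 1 = mult (dropCol mu) i then 1 - t ^ mult (dropCol mu) i
            else 1) = ∏ i ∈ Finset.Icc 1 ((dropCol mu).rowLen 0),
          (if mult lam (i + 1) + 1 = mult mu (i + 1) then 1 - t ^ mult mu (i + 1) else 1) := by
        refine Finset.prod_congr rfl fun i hi => ?_
        obtain ⟨j, rfl⟩ : ∃ j, i = j + 1 := ⟨i - 1, by have := (Finset.mem_Icc.1 hi).1; omega⟩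
        rw [mult_dropCol, mult_dropCol]
      rw [e2]
      simp only [e, ← mult_add_one mu 0]
      ring
    · intro h0
      rw [if_neg]
      rw [mult_add_one mu 0]
      omega
  · rw [skewP, if_neg h, colP, skewP]
    rw [interlaces_iff_dropCol, not_and_or] at h
    rcases h with h | h <;> rw [if_neg h] <;> simp

theorem skewQ_eq_colQ_mul (t x : ℝ) (lam mu : YoungDiagram) :
    skewQ t lam mu x =
      colQ t x (lam.colLen 0) (lam.colLen 1) (mu.colLen 0) (mu.colLen 1) *
        skewQ t (dropCol lam) (dropCol mu) x := by
  have hl := lam.colLen_anti 0 1 (Nat.zero_le _)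
  have hm := mu.colLen_anti 0 1 (Nat.zero_le _)
  by_cases h : Interlaces mu lam
  · have h' := interlaces_iff_dropCol.1 h
    simp only [skewQ, colQ]
    rw [if_pos h, if_pos h'.1, if_pos h'.2, card_sub_card_dropCol h, Finset.prod_filter,
      Finset.prod_filter, prod_Icc_rowLen_dropCol, pow_add]
    · have e : (lam.colLen 0 + mu.colLen 1 = mu.colLen 0 + lam.colLen 1 + 1) ↔
          mult lam 1 = mult mu 1 + 1 := by
        rw [mult_add_one lam 0, mult_add_one mu 0, Nat.zero_add]
        omega
      have e2 : ∏ i ∈ Finset.Icc 1 ((dropCol lam).rowLen 0),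
          (if mult (dropCol lam) i = mult (dropCol mu) i + 1 then 1 - t ^ mult (dropCol lam) i
            else 1) = ∏ i ∈ Finset.Icc 1 ((dropCol lam).rowLen 0),
          (if mult lam (i + 1) = mult mu (i + 1) + 1 then 1 - t ^ mult lam (i + 1) else 1) := by
        refine Finset.prod_congr rfl fun i hi => ?_
        obtain ⟨j, rfl⟩ : ∃ j, i = j + 1 := ⟨i - 1, by have := (Finset.mem_Icc.1 hi).1; omega⟩
        rw [mult_dropCol, mult_dropCol]
      rw [e2]
      simp only [e, ← mult_add_one lam 0]
      ring
    · intro h0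
      rw [if_neg]
      rw [mult_add_one lam 0]
      omega
  · rw [skewQ, if_neg h, colQ, skewQ]
    rw [interlaces_iff_dropCol, not_and_or] at h
    rcases h with h | h <;> rw [if_neg h] <;> simp

theorem colLen_zero_of_skewP_ne_zero {t x : ℝ} {lam mu : YoungDiagram}
    (h : skewP t lam mu x ≠ 0) :
    mu.colLen 0 ≤ lam.colLen 0 ∧ lam.colLen 0 ≤ mu.colLen 0 + 1 := by
  by_contra h'
  rw [skewP, if_neg (fun hi => h' (interlaces_iff_dropCol.1 hi).1)] at h
  exact h rfl

theorem colLen_zero_of_skewQ_ne_zero {t x : ℝ} {lam mu : YoungDiagram}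
    (h : skewQ t lam mu x ≠ 0) :
    mu.colLen 0 ≤ lam.colLen 0 ∧ lam.colLen 0 ≤ mu.colLen 0 + 1 := by
  by_contra h'
  rw [skewQ, if_neg (fun hi => h' (interlaces_iff_dropCol.1 hi).1)] at h
  exact h rfl

theorem skewP_nonneg {t x : ℝ} (ht0 : 0 ≤ t) (ht1 : t ≤ 1) (hx : 0 ≤ x) (lam mu : YoungDiagram) :
    0 ≤ skewP t lam mu x := by
  rw [skewP]
  split_ifs
  · exact mul_nonneg (pow_nonneg hx _)
      (Finset.prod_nonneg fun i _ => sub_nonneg.2 (pow_le_one₀ ht0 ht1))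
  · exact le_rfl

theorem skewQ_nonneg {t x : ℝ} (ht0 : 0 ≤ t) (ht1 : t ≤ 1) (hx : 0 ≤ x) (lam mu : YoungDiagram) :
    0 ≤ skewQ t lam mu x := by
  rw [skewQ]
  split_ifs
  · exact mul_nonneg (pow_nonneg hx _)
      (Finset.prod_nonneg fun i _ => sub_nonneg.2 (pow_le_one₀ ht0 ht1))
  · exact le_rfl

/-! ### The local exchange relation -/

/-- The coefficients of the exchange relation (occupation of the left, bottom, right and top edges):
six vertex weights multiplied by the normalization `(1 - t * w) / (1 - w)`. -/
noncomputable def exchCoef (t w : ℝ) : Bool → Bool → Bool → Bool → ℝ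
  | false, false, false, false => (1 - t * w) / (1 - w)
  | true, true, true, true => (1 - t * w) / (1 - w)
  | true, false, true, false => 1
  | true, false, false, true => (1 - t) * w / (1 - w)
  | false, true, false, true => t
  | false, true, true, false => (1 - t) / (1 - w)
  | _, _, _, _ => 0

/-- The summand for a pair of steps `mu ⊃ kap ⊂ nu`; `h` tells that the number of parts does not
drop in the first step, `v` that it grows in the second one. -/
noncomputable def valleyTerm (t a b : ℝ) (mu nu : YoungDiagram) (h v : Bool)
    (kap : YoungDiagram) : ℝ :=
  if kap.colLen 0 + v.toNat = nu.colLen 0 ∧ kap.colLen 0 + 1 = mu.colLen 0 + h.toNat then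
    skewP t nu kap a * skewQ t mu kap b else 0

/-- The summand for a pair of steps `mu ⊂ lam ⊃ nu`; `v` tells that the number of parts grows
in the first step, `h` that it does not drop in the second one. -/
noncomputable def peakTerm (t a b : ℝ) (mu nu : YoungDiagram) (h v : Bool)
    (lam : YoungDiagram) : ℝ :=
  if lam.colLen 0 = mu.colLen 0 + v.toNat ∧ lam.colLen 0 + h.toNat = nu.colLen 0 + 1 then
    skewP t lam mu a * skewQ t lam nu b else 0

/-- The factor contributed by the first column of `kap` or `lam` in `valleyTerm` and `peakTerm`. -/
noncomputable def colCoef (a b p q : ℝ) (h v h' v' : Bool) : ℝ :=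
  (if v then a else 1) * (if h then 1 else b) * (if !v && v' then 1 - p else 1) *
    (if !h && h' then 1 - q else 1)

/-- The exchange relation is compatible with the addition of a column. -/
theorem sum_colCoef_mul_exchCoef {t a b : ℝ} (hab : a * b ≠ 1) {m1 m n1 n : ℕ}
    {k : Bool → Bool → ℝ}
    (hk : ∀ h v : Bool, m1 + v.toNat + h.toNat ≠ n1 + 1 → k h v = 0) {h v : Bool}
    (hhv : m1 + m + v.toNat + h.toNat = n1 + n + 1) :
    ∑ h2, ∑ v2, colCoef a b (t ^ m) (t ^ (n + 1)) h v h2 v2 *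
        ∑ h3, ∑ v3, exchCoef t (a * b) h3 v3 h2 v2 * k h3 v3 =
      ∑ h2 : Bool, ∑ v2 : Bool, exchCoef t (a * b) h2 v2 h v *
        (if m1 + m + v2.toNat + h2.toNat = n1 + n + 1 then
          ∑ h3, ∑ v3, colCoef a b (t ^ (n + 1)) (t ^ m) h2 v2 h3 v3 * k h3 v3 else 0) := by
  have hw : 1 - a * b ≠ 0 := sub_ne_zero.2 (Ne.symm hab)
  have hw' : 1 - b * a ≠ 0 := by rwa [mul_comm]
  have e (h2 v2 : Bool) : m1 + m + v2.toNat + h2.toNat = n1 + n + 1 ↔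
      v2.toNat + h2.toNat = v.toNat + h.toNat := by omega
  have h00 := hk false false
  have h01 := hk false true
  have h10 := hk true false
  have h11 := hk true true
  simp only [Bool.toNat_false, Bool.toNat_true] at h00 h01 h10 h11
  simp only [Fintype.sum_bool, e]
  -- By `hk` only pairs with `v + h = n1 + 1 - m1` survive, and this number must be 0, 1 or 2. Once
  -- `hhv` relates `m` and `n`, each case is a rational identity in `a`, `b`, `t` and one power of
  -- `t`.
  by_cases c0 : m1 = n1 + 1
  · rw [h01 (by omega), h10 (by omega), h11 (by omega)]
    subst c0
    cases h <;> cases v <;> simp only [Bool.toNat_false, Bool.toNat_true] at hhv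
    · obtain rfl : n = m := by omega
      simp [colCoef, exchCoef]
      ring
    · obtain rfl : n = m + 1 := by omega
      simp [colCoef, exchCoef]
      field_simp
      ring
    · obtain rfl : n = m + 1 := by omega
      simp [colCoef, exchCoef]
      field_simp
      ring
    · obtain rfl : n = m + 2 := by omega
      simp [colCoef, exchCoef]
      field_simp
  by_cases c1 : m1 = n1
  · rw [h00 (by omega), h11 (by omega)]
    subst c1
    cases h <;> cases v <;> simp only [Bool.toNat_false, Bool.toNat_true] at hhv
    · obtain rfl : m = n + 1 := by omega
      simp [colCoef, exchCoef]
      field_simp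
      ring
    · obtain rfl : n = m := by omega
      simp [colCoef, exchCoef]
      field_simp
      ring
    · obtain rfl : n = m := by omega
      simp [colCoef, exchCoef]
      field_simp
      ring
    · obtain rfl : n = m + 1 := by omega
      simp [colCoef, exchCoef]
      field_simp
      ring
  by_cases c2 : m1 + 1 = n1
  · rw [h00 (by omega), h01 (by omega), h10 (by omega)]
    subst c2
    cases h <;> cases v <;> simp only [Bool.toNat_false, Bool.toNat_true] at hhv
    · obtain rfl : m = n + 2 := by omega
      simp [colCoef, exchCoef]
      field_simp
    · obtain rfl : m = n + 1 := by omega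
      simp [colCoef, exchCoef]
      field_simp
      ring
    · obtain rfl : m = n + 1 := by omega
      simp [colCoef, exchCoef]
      field_simp
      ring
    · obtain rfl : n = m := by omega
      simp [colCoef, exchCoef]
      ring
  · rw [h00 (by omega), h01 (by omega), h10 (by omega), h11 (by omega)]
    simp

/-- A diagram with first column of length `c` is determined by its other columns, so the sum can be
reindexed by them. This carries sums for `dropCol mu`, `dropCol nu` over to `mu`, `nu`. -/
theorem hasSum_of_hasSum_consCol {F : YoungDiagram → ℝ} {c : ℕ} {r : ℝ}
    (hF : ∀ lam, F lam ≠ 0 → lam.colLen 0 = c)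
    (h : HasSum (fun lam => if lam.colLen 0 ≤ c then F (consCol c lam) else 0) r) :
    HasSum F r := by
  have key := hasSum_iff_hasSum_of_ne_zero_bij (f := F) (a := r)
    (g := fun lam => if lam.colLen 0 ≤ c then F (consCol c lam) else 0)
    (fun x => consCol c x.1) ?_ ?_ ?_
  · exact key.2 h
  · intro x y hxy
    have := congrArg dropCol hxy
    simp only [dropCol_consCol] at this
    exact Subtype.ext this
  · intro lam hlam
    have hc := hF lam hlam
    have h1 := lam.colLen_anti 0 1 (Nat.zero_le _)
    have h2 : consCol c (dropCol lam) = lam := by rw [← hc, consCol_dropCol]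
    refine ⟨⟨dropCol lam, ?_⟩, h2⟩
    rw [Function.mem_support, colLen_dropCol, Nat.zero_add, if_pos (by omega), h2]
    exact hlam
  · rintro ⟨x, hx⟩
    by_cases hc : x.colLen 0 ≤ c
    · simp [hc]
    · simp [hc] at hx

/-- The multiplicity of the part size bounded by two adjacent columns drops exactly when the first
of them does not grow and the second does, so the column factor depends only on the bits and on one
multiplicity. -/
theorem colP_eq (t x : ℝ) {l0 l1 m0 m1 : ℕ} {v v' : Bool} (h0 : l0 = m0 + v.toNat)
    (h1 : l1 = m1 + v'.toNat) :
    colP t x l0 l1 m0 m1 =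
      (if v then x else 1) * (if !v && v' then 1 - t ^ (m0 - m1) else 1) := by
  subst h0 h1
  have e : m0 + v.toNat + 1 + m1 = m0 + (m1 + v'.toNat) ↔ (!v && v') = true := by
    cases v <;> cases v' <;> simp <;> omega
  rw [colP, if_pos (by have := Bool.toNat_le v; omega)]
  simp only [e]
  cases v <;> simp

theorem colQ_eq (t x : ℝ) {l0 l1 m0 m1 : ℕ} {h h' : Bool} (h0 : l0 + h.toNat = m0 + 1)
    (h1 : l1 + h'.toNat = m1 + 1) :
    colQ t x l0 l1 m0 m1 =
      (if h then 1 else x) * (if !h && h' then 1 - t ^ (l0 - l1) else 1) := by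
  have e : l0 + m1 = m0 + l1 + 1 ↔ (!h && h') = true := by
    cases h <;> cases h' <;> simp at * <;> omega
  have e' : l0 - m0 = if h then 0 else 1 := by
    cases h <;> simp at * <;> omega
  rw [colQ, if_pos (by have := Bool.toNat_le h; omega), e']
  simp only [e]
  cases h <;> simp

theorem colLen_consCol_one (c : ℕ) (lam : YoungDiagram) :
    (consCol c lam).colLen 1 = lam.colLen 0 := by
  rw [← colLen_dropCol (consCol c lam) 0, dropCol_consCol]

theorem sum_mul_ite_eq_and_eq (f : Bool → Bool → ℝ) (h v : Bool) (x : ℝ) :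
    ∑ h2, ∑ v2, f h2 v2 * (if h2 = h ∧ v2 = v then x else 0) = f h v * x := by
  cases h <;> cases v <;> simp

theorem exists_bool_toNat_eq {n m : ℕ} (h : m ≤ n ∧ n ≤ m + 1) : ∃ v : Bool, n = m + v.toNat := by
  rcases (by omega : n = m ∨ n = m + 1) with rfl | rfl
  exacts [⟨false, rfl⟩, ⟨true, rfl⟩]

theorem exists_bool_add_toNat_eq {n m : ℕ} (h : m ≤ n ∧ n ≤ m + 1) :
    ∃ v : Bool, n + v.toNat = m + 1 := by
  rcases (by omega : n = m ∨ n = m + 1) with rfl | rfl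
  exacts [⟨true, rfl⟩, ⟨false, rfl⟩]

theorem bool_toNat_inj {v w : Bool} : v.toNat = w.toNat ↔ v = w := by
  cases v <;> cases w <;> simp

section

variable (t a b : ℝ)

/-- The bits of the second column are determined by `lam`, so at most one summand on the right is
nonzero. The factor of `skewP` involves the multiplicity in the smaller diagram `mu`; that of
`skewQ` involves the multiplicity in `lam`, one more than in `nu`, whence the exponent with `+ 1`.
-/
theorem peakTerm_consCol (mu nu lam : YoungDiagram) (h v : Bool) :
    (if lam.colLen 0 ≤ mu.colLen 0 + v.toNat then
        peakTerm t a b mu nu h v (consCol (mu.colLen 0 + v.toNat) lam) else 0) =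
      if mu.colLen 0 + v.toNat + h.toNat = nu.colLen 0 + 1 then
        ∑ h2, ∑ v2, colCoef a b (t ^ (mu.colLen 0 - mu.colLen 1))
          (t ^ (nu.colLen 0 - nu.colLen 1 + 1)) h v h2 v2 *
            peakTerm t a b (dropCol mu) (dropCol nu) h2 v2 lam else 0 := by
  have hm := mu.colLen_anti 0 1 (Nat.zero_le _)
  have hn := nu.colLen_anti 0 1 (Nat.zero_le _)
  by_cases hPQ : skewP t lam (dropCol mu) a = 0 ∨ skewQ t lam (dropCol nu) b = 0
  · have h0 : skewP t lam (dropCol mu) a * skewQ t lam (dropCol nu) b = 0 := mul_eq_zero.2 hPQ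
    simp only [peakTerm, skewP_eq_colP_mul _ _ (consCol _ _), skewQ_eq_colQ_mul _ _ (consCol _ _),
      dropCol_consCol, mul_mul_mul_comm _ (skewP t lam (dropCol mu) a), h0]
    simp
  rw [not_or] at hPQ
  have hP := colLen_zero_of_skewP_ne_zero hPQ.1
  have hQ := colLen_zero_of_skewQ_ne_zero hPQ.2
  rw [colLen_dropCol, Nat.zero_add] at hP hQ
  by_cases hhv : mu.colLen 0 + v.toNat + h.toNat = nu.colLen 0 + 1
  · obtain ⟨v', hv'⟩ := exists_bool_toNat_eq hP
    obtain ⟨h', hh'⟩ := exists_bool_add_toNat_eq hQ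
    have e (h2 v2 : Bool) : (lam.colLen 0 = mu.colLen 1 + v2.toNat ∧
        lam.colLen 0 + h2.toNat = nu.colLen 1 + 1) ↔ h2 = h' ∧ v2 = v' := by
      rw [← bool_toNat_inj (v := h2), ← bool_toNat_inj (v := v2)]
      omega
    simp only [if_pos hhv, peakTerm, colLen_dropCol, Nat.zero_add, e, sum_mul_ite_eq_and_eq,
      skewP_eq_colP_mul _ _ (consCol _ _), skewQ_eq_colQ_mul _ _ (consCol _ _), dropCol_consCol,
      colLen_consCol_one, colLen_consCol]
    by_cases hc : lam.colLen 0 ≤ mu.colLen 0 + v.toNat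
    · rw [if_pos hc, max_eq_left hc, if_pos ⟨rfl, hhv⟩, mul_mul_mul_comm, colP_eq t a rfl hv',
        colQ_eq t b hhv hh', colCoef]
      congr 1
      have e' : (if (!h && h') = true then
          1 - t ^ (mu.colLen 0 + v.toNat - lam.colLen 0) else 1) =
          if (!h && h') = true then 1 - t ^ (nu.colLen 0 - nu.colLen 1 + 1) else 1 := by
        split_ifs with hh
        · obtain ⟨rfl, rfl⟩ : h = false ∧ h' = true := by simpa using hh
          simp only [Bool.toNat_false, Bool.toNat_true] at hhv hh'
          congr 2
          omega
        · rfl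
      rw [e']
      ring
    -- Here the prescribed first column is too short for `lam`. This forces `v = false`, `v' = true`
    -- and equal first two columns of `mu`, so the factor `1 - t ^ 0` annihilates the right side.
    · rw [if_neg hc]
      have h1 := Bool.toNat_le v'
      obtain ⟨rfl, rfl⟩ : v = false ∧ v' = true := by
        rw [← bool_toNat_inj, ← bool_toNat_inj, Bool.toNat_false, Bool.toNat_true]
        omega
      have h2 : mu.colLen 0 - mu.colLen 1 = 0 := by
        simp only [Bool.toNat_false, Bool.toNat_true] at hc hv'
        omega
      simp [colCoef, h2]
  · rw [if_neg hhv]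
    split_ifs with hc
    · rw [peakTerm, if_neg]
      rw [colLen_consCol]
      omega
    · rfl

/-- The mirror image of `peakTerm_consCol`: now `kap` is the smaller diagram in both steps, so the
`+ 1` moves to the factor of `skewP` and the exponents exchange their roles. -/
theorem valleyTerm_consCol (mu nu kap : YoungDiagram) (h v : Bool) :
    (if kap.colLen 0 ≤ nu.colLen 0 - v.toNat then
        valleyTerm t a b mu nu h v (consCol (nu.colLen 0 - v.toNat) kap) else 0) =
      if mu.colLen 0 + v.toNat + h.toNat = nu.colLen 0 + 1 then
        ∑ h2, ∑ v2, colCoef a b (t ^ (nu.colLen 0 - nu.colLen 1 + 1))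
          (t ^ (mu.colLen 0 - mu.colLen 1)) h v h2 v2 *
            valleyTerm t a b (dropCol mu) (dropCol nu) h2 v2 kap else 0 := by
  have hm := mu.colLen_anti 0 1 (Nat.zero_le _)
  have hn := nu.colLen_anti 0 1 (Nat.zero_le _)
  by_cases hPQ : skewP t (dropCol nu) kap a = 0 ∨ skewQ t (dropCol mu) kap b = 0
  · have h0 : skewP t (dropCol nu) kap a * skewQ t (dropCol mu) kap b = 0 := mul_eq_zero.2 hPQ
    simp only [valleyTerm, skewP_eq_colP_mul _ _ _ (consCol _ _),
      skewQ_eq_colQ_mul _ _ _ (consCol _ _),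
      dropCol_consCol, mul_mul_mul_comm _ (skewP t (dropCol nu) kap a), h0]
    simp
  rw [not_or] at hPQ
  have hP := colLen_zero_of_skewP_ne_zero hPQ.1
  have hQ := colLen_zero_of_skewQ_ne_zero hPQ.2
  rw [colLen_dropCol, Nat.zero_add] at hP hQ
  have hvle := Bool.toNat_le v
  by_cases hhv : mu.colLen 0 + v.toNat + h.toNat = nu.colLen 0 + 1
  · obtain ⟨v', hv'⟩ := exists_bool_toNat_eq hP
    obtain ⟨h', hh'⟩ := exists_bool_add_toNat_eq hQ
    have hvle' := Bool.toNat_le v'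
    have hhle' := Bool.toNat_le h'
    have e (h2 v2 : Bool) : (kap.colLen 0 + v2.toNat = nu.colLen 1 ∧
        kap.colLen 0 + 1 = mu.colLen 1 + h2.toNat) ↔ h2 = h' ∧ v2 = v' := by
      rw [← bool_toNat_inj (v := h2), ← bool_toNat_inj (v := v2)]
      omega
    simp only [if_pos hhv, valleyTerm, colLen_dropCol, Nat.zero_add, e, sum_mul_ite_eq_and_eq,
      skewP_eq_colP_mul _ _ _ (consCol _ _), skewQ_eq_colQ_mul _ _ _ (consCol _ _),
      dropCol_consCol, colLen_consCol_one, colLen_consCol]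
    by_cases hc : kap.colLen 0 ≤ nu.colLen 0 - v.toNat ∧ v.toNat ≤ nu.colLen 0
    · rw [if_pos hc.1, max_eq_left hc.1, if_pos ⟨by omega, by omega⟩, mul_mul_mul_comm,
        colP_eq t a (by omega : nu.colLen 0 = nu.colLen 0 - v.toNat + v.toNat) hv',
        colQ_eq t b (by omega : mu.colLen 0 + h.toNat = nu.colLen 0 - v.toNat + 1) hh', colCoef]
      congr 1
      have e' : (if (!v && v') = true then
          1 - t ^ (nu.colLen 0 - v.toNat - kap.colLen 0) else 1) =
          if (!v && v') = true then 1 - t ^ (nu.colLen 0 - nu.colLen 1 + 1) else 1 := by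
        split_ifs with hh
        · obtain ⟨rfl, rfl⟩ : v = false ∧ v' = true := by simpa using hh
          simp only [Bool.toNat_false, Bool.toNat_true] at hc hhv hv' ⊢
          congr 2
          omega
        · rfl
      rw [e']
      ring
    -- Either the first column is too short for `kap`, or its length `nu.colLen 0 - v.toNat` is
    -- truncated. In both cases the first two columns of `mu` have equal length, and the factor `1 -
    -- t ^ 0` makes the right side vanish.
    · obtain ⟨rfl, rfl⟩ : h = false ∧ h' = true := by
        rw [← bool_toNat_inj, ← bool_toNat_inj, Bool.toNat_false, Bool.toNat_true]
        omega
      have h2 : mu.colLen 0 - mu.colLen 1 = 0 := by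
        simp only [Bool.toNat_false, Bool.toNat_true] at hhv hh'
        omega
      have h3 : ¬(v.toNat ≤ nu.colLen 0 ∧ kap.colLen 0 ≤ nu.colLen 0 - v.toNat) := by tauto
      have e'' : (if kap.colLen 0 ≤ nu.colLen 0 - v.toNat then
          if max (nu.colLen 0 - v.toNat) (kap.colLen 0) + v.toNat = nu.colLen 0 ∧
              max (nu.colLen 0 - v.toNat) (kap.colLen 0) + 1 = mu.colLen 0 + false.toNat then
            colP t a (nu.colLen 0) (nu.colLen 1)
              (max (nu.colLen 0 - v.toNat) (kap.colLen 0)) (kap.colLen 0) *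
              skewP t (dropCol nu) kap a *
              (colQ t b (mu.colLen 0) (mu.colLen 1)
                (max (nu.colLen 0 - v.toNat) (kap.colLen 0)) (kap.colLen 0) *
              skewQ t (dropCol mu) kap b) else 0 else 0) = 0 := by
        split_ifs <;> first | rfl | omega
      rw [e'']
      simp [colCoef, h2]
  · rw [if_neg hhv]
    split_ifs with hc
    · rw [valleyTerm, if_neg]
      rw [colLen_consCol]
      omega
    · rfl

variable {t a b}

/-- The inductive step of the exchange relation. The valley sums `k` are only asserted to exist:
their values are never needed, only the linear relation between them and the peak sums. -/
theorem exists_hasSum_of_dropCol {mu nu : YoungDiagram} (hab : a * b ≠ 1) {k : Bool → Bool → ℝ}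
    (hk : ∀ h v, HasSum (valleyTerm t a b (dropCol mu) (dropCol nu) h v) (k h v))
    (hl : ∀ h v, HasSum (peakTerm t a b (dropCol mu) (dropCol nu) h v)
      (∑ h2, ∑ v2, exchCoef t (a * b) h2 v2 h v * k h2 v2)) :
    ∃ k' : Bool → Bool → ℝ, (∀ h v, HasSum (valleyTerm t a b mu nu h v) (k' h v)) ∧
      ∀ h v, HasSum (peakTerm t a b mu nu h v)
        (∑ h2, ∑ v2, exchCoef t (a * b) h2 v2 h v * k' h2 v2) := by
  obtain ⟨m, hm⟩ := Nat.exists_eq_add_of_le (mu.colLen_anti 0 1 (Nat.zero_le _))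
  obtain ⟨n, hn⟩ := Nat.exists_eq_add_of_le (nu.colLen_anti 0 1 (Nat.zero_le _))
  have hm' : mu.colLen 0 - mu.colLen 1 = m := by omega
  have hn' : nu.colLen 0 - nu.colLen 1 = n := by omega
  have hk0 (h v : Bool) (hne : mu.colLen 1 + v.toNat + h.toNat ≠ nu.colLen 1 + 1) :
      k h v = 0 := by
    refine (hk h v).unique ?_
    convert! (hasSum_zero : HasSum (fun _ : YoungDiagram => (0 : ℝ)) 0) using 1
    funext kap
    rw [valleyTerm, if_neg]
    rw [colLen_dropCol, colLen_dropCol, Nat.zero_add]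
    omega
  refine ⟨fun h v => if mu.colLen 1 + m + v.toNat + h.toNat = nu.colLen 1 + n + 1 then
    ∑ h2, ∑ v2, colCoef a b (t ^ (n + 1)) (t ^ m) h v h2 v2 * k h2 v2 else 0, ?_, ?_⟩
  · intro h v
    apply hasSum_of_hasSum_consCol (c := nu.colLen 0 - v.toNat)
    · intro kap hne
      rw [valleyTerm] at hne
      split_ifs at hne with hc
      · omega
      · exact absurd rfl hne
    · simp only [valleyTerm_consCol, hm', hn', ← hm, ← hn]
      split_ifs
      · exact hasSum_sum fun h2 _ => hasSum_sum fun v2 _ => (hk h2 v2).mul_left _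
      · exact hasSum_zero
  · intro h v
    apply hasSum_of_hasSum_consCol (c := mu.colLen 0 + v.toNat)
    · intro lam hne
      rw [peakTerm] at hne
      split_ifs at hne with hc
      · exact hc.1
      · exact absurd rfl hne
    · simp only [peakTerm_consCol, hm', hn']
      split_ifs with hhv
      · rw [← sum_colCoef_mul_exchCoef hab hk0 (by omega)]
        exact hasSum_sum fun h2 _ => hasSum_sum fun v2 _ => (hl h2 v2).mul_left _
      -- The bits `h`, `v` violate the conservation law imposed by `mu` and `nu`, so there are no
      -- peaks. On the other side, a nonzero coefficient preserves `v + h` and hence the violation.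
      · convert! (hasSum_zero : HasSum (fun _ : YoungDiagram => (0 : ℝ)) 0) using 1
        have : ∀ h2 v2 : Bool, exchCoef t (a * b) h2 v2 h v *
            (if mu.colLen 1 + m + v2.toNat + h2.toNat = nu.colLen 1 + n + 1 then
              ∑ h3, ∑ v3, colCoef a b (t ^ (n + 1)) (t ^ m) h2 v2 h3 v3 * k h3 v3 else 0) = 0 := by
          intro h2 v2
          split_ifs with h'
          · have hne : v2.toNat + h2.toNat ≠ v.toNat + h.toNat := by omega
            have : exchCoef t (a * b) h2 v2 h v = 0 := by
              cases h <;> cases v <;> cases h2 <;> cases v2 <;> simp [exchCoef] at hne ⊢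
            rw [this, zero_mul]
          · rw [mul_zero]
        exact Finset.sum_eq_zero fun h2 _ => Finset.sum_eq_zero fun v2 _ => this h2 v2

/-! ### The exchange relation for empty diagrams -/

/-- The diagram with a single row of length `n`. -/
def oneRow (n : ℕ) : YoungDiagram := (consCol 1)^[n] ⊥

theorem colLen_oneRow_succ (n : ℕ) : (oneRow (n + 1)).colLen 0 = 1 := by
  induction n with
  | zero => rw [oneRow, Function.iterate_succ_apply', Function.iterate_zero, colLen_consCol, id,
      colLen_bot]; rfl
  | succ n ih => rw [oneRow, Function.iterate_succ_apply', colLen_consCol, ← oneRow, ih]; rfl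

theorem dropCol_oneRow_succ (n : ℕ) : dropCol (oneRow (n + 1)) = oneRow n := by
  rw [oneRow, Function.iterate_succ_apply', dropCol_consCol, ← oneRow]

theorem eq_oneRow {lam : YoungDiagram} (h : lam.colLen 0 ≤ 1) : lam = oneRow (lam.rowLen 0) := by
  generalize hn : lam.rowLen 0 = n
  induction n generalizing lam with
  | zero => exact eq_bot_of_rowLen_eq_zero hn
  | succ n ih =>
    have h1 : lam.colLen 0 = 1 := by
      refine le_antisymm h (Nat.one_le_iff_ne_zero.2 fun h0 => ?_)
      rw [eq_bot_of_colLen_eq_zero h0, rowLen_bot] at hn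
      omega
    have h2 : dropCol lam = oneRow n := by
      refine ih ?_ ?_
      · rw [colLen_dropCol]
        exact (lam.colLen_anti 0 1 (Nat.zero_le _)).trans h
      · rw [rowLen_dropCol, hn]
        rfl
    rw [← consCol_dropCol lam, h1, h2, oneRow, oneRow, Function.iterate_succ_apply']

theorem oneRow_injective : Function.Injective oneRow := by
  intro m
  induction m with
  | zero =>
    rintro (_ | n) h
    · rfl
    · have := congrArg (fun l => YoungDiagram.colLen l 0) h
      simp only [colLen_oneRow_succ] at this
      rw [oneRow, Function.iterate_zero, id, colLen_bot] at this
      omega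
  | succ m ih =>
    rintro (_ | n) h
    · have := congrArg (fun l => YoungDiagram.colLen l 0) h
      simp only [colLen_oneRow_succ] at this
      rw [oneRow, Function.iterate_zero, id, colLen_bot] at this
      omega
    · have := congrArg dropCol h
      rw [dropCol_oneRow_succ, dropCol_oneRow_succ] at this
      rw [ih this]

theorem interlaces_bot : Interlaces ⊥ ⊥ := fun i => by simp [rowLen_bot]

theorem skewP_bot (t x : ℝ) : skewP t ⊥ ⊥ x = 1 := by
  rw [skewP, if_pos interlaces_bot, rowLen_bot]
  simp

theorem skewQ_bot (t x : ℝ) : skewQ t ⊥ ⊥ x = 1 := by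
  rw [skewQ, if_pos interlaces_bot, rowLen_bot]
  simp

theorem skewP_oneRow (t x : ℝ) (n : ℕ) : skewP t (oneRow n) ⊥ x = x ^ n := by
  induction n with
  | zero => rw [oneRow, Function.iterate_zero, id, skewP_bot, pow_zero]
  | succ n ih =>
    rw [skewP_eq_colP_mul, dropCol_oneRow_succ, dropCol_bot, ih, colLen_oneRow_succ, colLen_bot,
      colLen_bot, ← colLen_dropCol, dropCol_oneRow_succ, colP]
    have : ∀ m, (oneRow m).colLen 0 ≠ 2 := by
      rintro (_ | m)
      · rw [oneRow, Function.iterate_zero, id, colLen_bot]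
        omega
      · rw [colLen_oneRow_succ]
        omega
    simp [(this n).symm]
    ring

theorem skewQ_oneRow_succ (t x : ℝ) (n : ℕ) :
    skewQ t (oneRow (n + 1)) ⊥ x = (1 - t) * x ^ (n + 1) := by
  induction n with
  | zero =>
    rw [skewQ_eq_colQ_mul, dropCol_oneRow_succ, dropCol_bot, colLen_oneRow_succ, colLen_bot,
      colLen_bot, ← colLen_dropCol, dropCol_oneRow_succ, oneRow, Function.iterate_zero, id,
      colLen_bot, skewQ_bot, colQ]
    simp
    ring
  | succ n ih =>
    rw [skewQ_eq_colQ_mul, dropCol_oneRow_succ, dropCol_bot, ih, colLen_oneRow_succ, colLen_bot,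
      colLen_bot, ← colLen_dropCol, dropCol_oneRow_succ, colLen_oneRow_succ, colQ]
    simp
    ring

theorem hasSum_ite_eq_bot {p : YoungDiagram → Prop} [DecidablePred p] {f : YoungDiagram → ℝ}
    {r : ℝ} (hp : ∀ lam, p lam → lam = ⊥) (hr : (if p ⊥ then f ⊥ else 0) = r) :
    HasSum (fun lam => if p lam then f lam else 0) r := by
  rw [← hr]
  refine hasSum_single _ fun lam hne => ?_
  rw [if_neg fun h => hne (hp _ h)]

theorem exists_hasSum_bot (h0 : 0 ≤ a * b) (h1 : a * b < 1) :
    ∃ k : Bool → Bool → ℝ, (∀ h v, HasSum (valleyTerm t a b ⊥ ⊥ h v) (k h v)) ∧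
      ∀ h v, HasSum (peakTerm t a b ⊥ ⊥ h v)
        (∑ h2, ∑ v2, exchCoef t (a * b) h2 v2 h v * k h2 v2) := by
  have hb (lam : YoungDiagram) (h : lam.colLen 0 = 0) : lam = ⊥ := eq_bot_of_colLen_eq_zero h
  -- Below two empty diagrams there is only `⊥`, with no part lost and none gained.
  refine ⟨fun h v => if h = true ∧ v = false then 1 else 0, fun h v => ?_, fun h v => ?_⟩
  · refine hasSum_ite_eq_bot (fun lam hl => hb _ ?_) ?_
    · rw [colLen_bot] at hl
      omega
    · simp only [colLen_bot, skewP_bot, skewQ_bot]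
      cases h <;> cases v <;> simp
  -- This is the only pair of bits that allows a nonempty peak: a nonempty row, of weight `(1 - t) *
  -- (a * b) ^ n` when its length is `n`. Any other peak must be `⊥`.
  · by_cases hhv : h = false ∧ v = true
    · obtain ⟨rfl, rfl⟩ := hhv
      have hs : HasSum (fun n : ℕ => (1 - t) * (a * b) * (a * b) ^ n)
          ((1 - t) * (a * b) * (1 - a * b)⁻¹) :=
        (hasSum_geometric_of_lt_one h0 h1).mul_left _
      have hinj : Function.Injective fun n => oneRow (n + 1) :=
        fun m n hmn => Nat.succ_injective (oneRow_injective hmn)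
      have e : (∑ h2 : Bool, ∑ v2 : Bool, exchCoef t (a * b) h2 v2 false true *
          if h2 = true ∧ v2 = false then 1 else 0) = (1 - t) * (a * b) * (1 - a * b)⁻¹ := by
        simp [exchCoef, div_eq_mul_inv]
      rw [e]
      refine (hinj.hasSum_iff fun lam hl => ?_).1 ?_
      · rw [peakTerm, if_neg]
        rintro ⟨hl1, -⟩
        rw [colLen_bot, Bool.toNat_true] at hl1
        refine hl ⟨lam.rowLen 0 - 1, ?_⟩
        have hpos : lam.rowLen 0 ≠ 0 := fun h => by
          rw [eq_bot_of_rowLen_eq_zero h, colLen_bot] at hl1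
          omega
        simp only [Nat.sub_add_cancel (Nat.one_le_iff_ne_zero.2 hpos)]
        exact (eq_oneRow (by omega)).symm
      · convert! hs using 1
        funext n
        rw [Function.comp_apply, peakTerm, colLen_oneRow_succ, colLen_bot, if_pos (by simp),
          skewP_oneRow, skewQ_oneRow_succ]
        ring
    · refine hasSum_ite_eq_bot (fun lam hl => hb _ ?_) ?_
      · rw [colLen_bot] at hl
        cases h <;> cases v <;> simp at hl hhv ⊢ <;> omega
      · simp only [colLen_bot, skewP_bot, skewQ_bot]
        cases h <;> cases v <;> simp [exchCoef] at hhv ⊢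

/-- The exchange relation: sums over the diagrams above `mu` and `nu` in terms of sums over
the diagrams below `mu` and `nu`. -/
theorem exists_hasSum_valleyTerm_peakTerm (h0 : 0 ≤ a * b) (h1 : a * b < 1)
    (mu nu : YoungDiagram) :
    ∃ k : Bool → Bool → ℝ, (∀ h v, HasSum (valleyTerm t a b mu nu h v) (k h v)) ∧
      ∀ h v, HasSum (peakTerm t a b mu nu h v)
        (∑ h2, ∑ v2, exchCoef t (a * b) h2 v2 h v * k h2 v2) := by
  obtain ⟨n, hn⟩ : ∃ n, mu.rowLen 0 ≤ n ∧ nu.rowLen 0 ≤ n := ⟨_, le_max_left _ _, le_max_right _ _⟩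
  -- The induction is on a common bound for the numbers of columns of both diagrams, since `dropCol`
  -- is applied to both at once.
  induction n generalizing mu nu with
  | zero =>
    rw [eq_bot_of_rowLen_eq_zero (Nat.le_zero.1 hn.1), eq_bot_of_rowLen_eq_zero (Nat.le_zero.1 hn.2)]
    exact exists_hasSum_bot h0 h1
  | succ n ih =>
    obtain ⟨k, hk, hl⟩ := ih (dropCol mu) (dropCol nu)
      ⟨by rw [rowLen_dropCol]; omega, by rw [rowLen_dropCol]; omega⟩
    exact exists_hasSum_of_dropCol h1.ne hk hl

end

/-! ### Nonnegative kernels on Young diagrams -/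

/-- The action of a kernel on functions. -/
noncomputable def applyKernel {S : Type*} (K : S → S → ENNReal) (f : S → ENNReal) (x : S) :
    ENNReal :=
  ∑' y, K x y * f y

theorem applyKernel_sum {S ι : Type*} (K : S → S → ENNReal) (s : Finset ι) (c : ι → ENNReal)
    (g : ι → S → ENNReal) (x : S) :
    applyKernel K (fun y => ∑ i ∈ s, c i * g i y) x = ∑ i ∈ s, c i * applyKernel K (g i) x := by
  simp only [applyKernel, Finset.mul_sum]
  rw [Summable.tsum_finsetSum fun _ _ => ENNReal.summable]
  refine Finset.sum_congr rfl fun i _ => ?_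
  rw [← ENNReal.tsum_mul_left]
  exact tsum_congr fun y => mul_left_comm _ _ _

theorem applyKernel_applyKernel {S : Type*} (K L : S → S → ENNReal) (f : S → ENNReal) (x : S) :
    applyKernel K (applyKernel L f) x = ∑' z, (∑' y, K x y * L y z) * f z := by
  simp only [applyKernel, ← ENNReal.tsum_mul_left, ← ENNReal.tsum_mul_right]
  rw [ENNReal.tsum_comm]
  simp only [mul_assoc]

theorem foldr_applyKernel_sum {S ι : Type*} (l : List (S → S → ENNReal)) (s : Finset ι)
    (c : ι → ENNReal) (g : ι → S → ENNReal) (x : S) :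
    l.foldr applyKernel (fun y => ∑ i ∈ s, c i * g i y) x =
      ∑ i ∈ s, c i * l.foldr applyKernel (g i) x := by
  induction l generalizing x with
  | nil => rfl
  | cons K l ih =>
    simp only [List.foldr_cons]
    rw [← applyKernel_sum]
    congr 1
    exact funext ih

/-- The kernel of an ascending step; `v` tells that the number of parts grows. -/
noncomputable def upKernel (t a : ℝ) (v : Bool) (mu lam : YoungDiagram) : ENNReal :=
  if decide (mu.colLen 0 = lam.colLen 0) = !v then ENNReal.ofReal (skewP t lam mu a) else 0

/-- The kernel of a descending step; `h` tells that the number of parts does not drop. -/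
noncomputable def downKernel (t b : ℝ) (h : Bool) (lam nu : YoungDiagram) : ENNReal :=
  if decide (lam.colLen 0 = nu.colLen 0 + 1) = !h then ENNReal.ofReal (skewQ t lam nu b) else 0

section

variable {t a b : ℝ}

/-- The kernels test signs literally as `supportString` does, while `peakTerm` uses equations
between column lengths. The two conditions agree wherever the skew polynomials are nonzero, because
there the lengths differ by at most one. -/
theorem upKernel_mul_downKernel (ht0 : 0 ≤ t) (ht1 : t ≤ 1) (ha : 0 ≤ a)
    (h v : Bool) (mu nu lam : YoungDiagram) :
    upKernel t a v mu lam * downKernel t b h lam nu =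
      ENNReal.ofReal (peakTerm t a b mu nu h v lam) := by
  by_cases hPQ : skewP t lam mu a = 0 ∨ skewQ t lam nu b = 0
  · rw [peakTerm, mul_eq_zero.2 hPQ, ite_self, ENNReal.ofReal_zero, mul_eq_zero]
    refine hPQ.imp (fun h0 => ?_) fun h0 => ?_
    · rw [upKernel, h0, ENNReal.ofReal_zero, ite_self]
    · rw [downKernel, h0, ENNReal.ofReal_zero, ite_self]
  · rw [not_or] at hPQ
    have hP := colLen_zero_of_skewP_ne_zero hPQ.1
    have hQ := colLen_zero_of_skewQ_ne_zero hPQ.2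
    have e1 : decide (mu.colLen 0 = lam.colLen 0) = (!v) ↔
        lam.colLen 0 = mu.colLen 0 + v.toNat := by
      cases v <;> simp <;> omega
    have e2 : decide (lam.colLen 0 = nu.colLen 0 + 1) = (!h) ↔
        lam.colLen 0 + h.toNat = nu.colLen 0 + 1 := by
      cases h <;> simp <;> omega
    simp only [upKernel, downKernel, e1, e2, peakTerm, ite_and]
    split_ifs <;> simp [ENNReal.ofReal_mul (skewP_nonneg ht0 ht1 ha lam mu)]

theorem downKernel_mul_upKernel (ht0 : 0 ≤ t) (ht1 : t ≤ 1) (ha : 0 ≤ a)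
    (h v : Bool) (mu nu kap : YoungDiagram) :
    downKernel t b h mu kap * upKernel t a v kap nu =
      ENNReal.ofReal (valleyTerm t a b mu nu h v kap) := by
  by_cases hPQ : skewP t nu kap a = 0 ∨ skewQ t mu kap b = 0
  · rw [valleyTerm, mul_eq_zero.2 hPQ, ite_self, ENNReal.ofReal_zero, mul_eq_zero]
    refine hPQ.symm.imp (fun h0 => ?_) fun h0 => ?_
    · rw [downKernel, h0, ENNReal.ofReal_zero, ite_self]
    · rw [upKernel, h0, ENNReal.ofReal_zero, ite_self]
  · rw [not_or] at hPQ
    have hP := colLen_zero_of_skewP_ne_zero hPQ.1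
    have hQ := colLen_zero_of_skewQ_ne_zero hPQ.2
    have e1 : decide (kap.colLen 0 = nu.colLen 0) = (!v) ↔
        kap.colLen 0 + v.toNat = nu.colLen 0 := by
      cases v <;> simp <;> omega
    have e2 : decide (mu.colLen 0 = kap.colLen 0 + 1) = (!h) ↔
        kap.colLen 0 + 1 = mu.colLen 0 + h.toNat := by
      cases h <;> simp <;> omega
    simp only [upKernel, downKernel, e1, e2, valleyTerm, ite_and]
    split_ifs <;> simp [ENNReal.ofReal_mul (skewP_nonneg ht0 ht1 ha nu kap), mul_comm]

theorem tsum_ofReal_eq_of_hasSum {S : Type*} {f : S → ℝ} {r : ℝ} (hf : ∀ x, 0 ≤ f x)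
    (h : HasSum f r) : ∑' x, ENNReal.ofReal (f x) = ENNReal.ofReal r := by
  rw [← h.tsum_eq, ENNReal.ofReal_tsum_of_nonneg hf h.summable]

theorem peakTerm_nonneg (ht0 : 0 ≤ t) (ht1 : t ≤ 1) (ha : 0 ≤ a) (hb : 0 ≤ b)
    (mu nu : YoungDiagram) (h v : Bool) (lam : YoungDiagram) :
    0 ≤ peakTerm t a b mu nu h v lam := by
  rw [peakTerm]
  split_ifs
  exacts [mul_nonneg (skewP_nonneg ht0 ht1 ha _ _) (skewQ_nonneg ht0 ht1 hb _ _), le_rfl]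

theorem valleyTerm_nonneg (ht0 : 0 ≤ t) (ht1 : t ≤ 1) (ha : 0 ≤ a) (hb : 0 ≤ b)
    (mu nu : YoungDiagram) (h v : Bool) (kap : YoungDiagram) :
    0 ≤ valleyTerm t a b mu nu h v kap := by
  rw [valleyTerm]
  split_ifs
  exacts [mul_nonneg (skewP_nonneg ht0 ht1 ha _ _) (skewQ_nonneg ht0 ht1 hb _ _), le_rfl]

theorem exchCoef_nonneg {w : ℝ} (ht0 : 0 ≤ t) (ht1 : t ≤ 1) (hw0 : 0 ≤ w) (hw1 : w ≤ 1)
    (l d r u : Bool) : 0 ≤ exchCoef t w l d r u := by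
  have h1 : 0 ≤ 1 - t := sub_nonneg.2 ht1
  have h2 : 0 ≤ 1 - w := sub_nonneg.2 hw1
  have h3 : 0 ≤ 1 - t * w := sub_nonneg.2 (mul_le_one₀ ht1 hw0 hw1)
  cases l <;> cases d <;> cases r <;> cases u <;> simp only [exchCoef] <;> positivity

theorem tsum_upKernel_mul_downKernel (ht0 : 0 ≤ t) (ht1 : t ≤ 1) (ha : 0 ≤ a) (hb : 0 ≤ b)
    (hab : a * b < 1) (h v : Bool) (mu nu : YoungDiagram) :
    ∑' lam, upKernel t a v mu lam * downKernel t b h lam nu =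
      ∑ h2, ∑ v2, ENNReal.ofReal (exchCoef t (a * b) h2 v2 h v) *
        ∑' kap, downKernel t b h2 mu kap * upKernel t a v2 kap nu := by
  obtain ⟨k, hk, hl⟩ := exists_hasSum_valleyTerm_peakTerm (t := t) (mul_nonneg ha hb) hab mu nu
  have hc := exchCoef_nonneg ht0 ht1 (mul_nonneg ha hb) hab.le
  have hk0 (h2 v2 : Bool) : 0 ≤ k h2 v2 :=
    (hk h2 v2).nonneg (valleyTerm_nonneg ht0 ht1 ha hb mu nu h2 v2)
  simp only [upKernel_mul_downKernel ht0 ht1 ha, downKernel_mul_upKernel ht0 ht1 ha]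
  rw [tsum_ofReal_eq_of_hasSum (peakTerm_nonneg ht0 ht1 ha hb mu nu h v) (hl h v),
    ENNReal.ofReal_sum_of_nonneg fun h2 _ =>
      Finset.sum_nonneg fun v2 _ => mul_nonneg (hc h2 v2 h v) (hk0 h2 v2)]
  refine Finset.sum_congr rfl fun h2 _ => ?_
  rw [ENNReal.ofReal_sum_of_nonneg fun v2 _ => mul_nonneg (hc h2 v2 h v) (hk0 h2 v2)]
  refine Finset.sum_congr rfl fun v2 _ => ?_
  rw [tsum_ofReal_eq_of_hasSum (valleyTerm_nonneg ht0 ht1 ha hb mu nu h2 v2) (hk h2 v2),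
    ENNReal.ofReal_mul (hc h2 v2 h v)]

theorem applyKernel_upKernel_downKernel (ht0 : 0 ≤ t) (ht1 : t ≤ 1) (ha : 0 ≤ a) (hb : 0 ≤ b)
    (hab : a * b < 1) (h v : Bool) (f : YoungDiagram → ENNReal) (x : YoungDiagram) :
    applyKernel (upKernel t a v) (applyKernel (downKernel t b h) f) x =
      ∑ h2, ∑ v2, ENNReal.ofReal (exchCoef t (a * b) h2 v2 h v) *
        applyKernel (downKernel t b h2) (applyKernel (upKernel t a v2) f) x := by
  simp only [applyKernel_applyKernel, tsum_upKernel_mul_downKernel ht0 ht1 ha hb hab,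
    Finset.sum_mul]
  rw [Summable.tsum_finsetSum fun _ _ => ENNReal.summable]
  refine Finset.sum_congr rfl fun h2 _ => ?_
  rw [Summable.tsum_finsetSum fun _ _ => ENNReal.summable]
  simp only [mul_assoc, ENNReal.tsum_mul_left]

end

/-! ### Transfer sums -/

/-- The sum over all paths from `s` to `s'` of the products of the weights of their steps. -/
noncomputable def transferSum {S : Type*} [Fintype S] [DecidableEq S] {n : ℕ}
    (K : Fin n → S → S → ENNReal) (s s' : S) : ENNReal :=
  ∑ p : Fin (n + 1) → S,
    if p 0 = s ∧ p (Fin.last n) = s' then ∏ i : Fin n, K i (p i.castSucc) (p i.succ) else 0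

theorem transferSum_zero {S : Type*} [Fintype S] [DecidableEq S] (K : Fin 0 → S → S → ENNReal)
    (s s' : S) : transferSum K s s' = if s = s' then 1 else 0 := by
  rw [transferSum, ← (Equiv.funUnique (Fin 1) S).symm.sum_comp]
  have : ∀ x : S, (x = s ∧ x = s') ↔ (x = s ∧ s = s') := by
    intro x
    constructor <;> rintro ⟨rfl, h⟩ <;> exact ⟨rfl, h⟩
  simp [this, ite_and]

theorem transferSum_succ {S : Type*} [Fintype S] [DecidableEq S] {n : ℕ}
    (K : Fin (n + 1) → S → S → ENNReal) (s s' : S) :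
    transferSum K s s' =
      ∑ x, transferSum (fun i => K i.castSucc) s x * K (Fin.last n) x s' := by
  rw [transferSum, ← (Fin.snocEquiv fun _ : Fin (n + 2) => S).sum_comp, Fintype.sum_prod_type_right]
  simp only [transferSum, Finset.sum_mul]
  conv_rhs => rw [Finset.sum_comm]
  refine Finset.sum_congr rfl fun p _ => ?_
  have h0 : ∀ x : S, (Fin.snoc p x : Fin (n + 2) → S) 0 = p 0 := fun x =>
    Fin.snoc_castSucc (α := fun _ => S) x p 0
  simp only [Fin.snocEquiv_apply, h0, Fin.snoc_last, Fin.prod_univ_castSucc, Fin.succ_last,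
    ← Fin.castSucc_succ, Fin.snoc_castSucc, Nat.succ_eq_add_one]
  by_cases h : p 0 = s <;> simp [h]

/-! ### Moving ascending steps through descending steps -/

/-- The indicator function of the empty diagram. -/
noncomputable def botIndicator (x : YoungDiagram) : ENNReal := by
  classical exact if x = ⊥ then 1 else 0

theorem applyKernel_botIndicator (K : YoungDiagram → YoungDiagram → ENNReal) (x : YoungDiagram) :
    applyKernel K botIndicator x = K x ⊥ := by
  rw [applyKernel, tsum_eq_single ⊥]
  · simp [botIndicator]
  · intro y hy
    simp [botIndicator, hy]

/-- The source of the empty bottom boundary: an ascending step that ends at `⊥` starts there and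
gains no part. -/
theorem upKernel_bot (t a : ℝ) (v : Bool) (x : YoungDiagram) :
    upKernel t a v x ⊥ = if false = v then botIndicator x else 0 := by
  by_cases hx : x = ⊥
  · subst hx
    cases v <;> simp [upKernel, botIndicator, skewP_bot]
  · have : skewP t ⊥ x a = 0 := by
      by_contra h
      have := (colLen_zero_of_skewP_ne_zero h).1
      rw [colLen_bot] at this
      exact hx (eq_bot_of_colLen_eq_zero (Nat.le_zero.1 this))
    simp [upKernel, botIndicator, this, hx]

/-- The source of the occupied left boundary: a descending step from `⊥` stays there and loses no
part. -/
theorem applyKernel_downKernel_bot (t b : ℝ) (h : Bool) (f : YoungDiagram → ENNReal) :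
    applyKernel (downKernel t b h) f ⊥ = if true = h then f ⊥ else 0 := by
  rw [applyKernel, tsum_eq_single ⊥]
  · cases h <;> simp [downKernel, skewQ_bot, colLen_bot]
  · intro y hy
    have : skewQ t ⊥ y b = 0 := by
      by_contra h
      have := (colLen_zero_of_skewQ_ne_zero h).1
      rw [colLen_bot] at this
      exact hy (eq_bot_of_colLen_eq_zero (Nat.le_zero.1 this))
    simp [downKernel, this]

/-- The ascending steps with parameters `a` and prescribed changes `v` of the number of parts. -/
noncomputable def upSteps (t : ℝ) {M : ℕ} (a : Fin M → ℝ) (v : Fin M → Bool)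
    (f : YoungDiagram → ENNReal) : YoungDiagram → ENNReal :=
  (List.ofFn fun i => upKernel t (a i) (v i)).foldr applyKernel f

/-- The descending steps with parameters `b`, in decreasing order of the index. -/
noncomputable def downSteps (t : ℝ) {N : ℕ} (b : Fin N → ℝ) (h : Fin N → Bool)
    (f : YoungDiagram → ENNReal) : YoungDiagram → ENNReal :=
  (List.ofFn fun j : Fin N => downKernel t (b j.rev) (h j.rev)).foldr applyKernel f

theorem upSteps_succ (t : ℝ) {M : ℕ} (a : Fin (M + 1) → ℝ) (v : Fin (M + 1) → Bool)
    (f : YoungDiagram → ENNReal) :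
    upSteps t a v f = upSteps t (fun i => a i.castSucc) (fun i => v i.castSucc)
      (applyKernel (upKernel t (a (Fin.last M)) (v (Fin.last M))) f) := by
  rw [upSteps, List.ofFn_succ_last, List.foldr_append]
  rfl

theorem downSteps_succ (t : ℝ) {N : ℕ} (b : Fin (N + 1) → ℝ) (h : Fin (N + 1) → Bool)
    (f : YoungDiagram → ENNReal) :
    downSteps t b h f = applyKernel (downKernel t (b (Fin.last N)) (h (Fin.last N)))
      (downSteps t (fun j => b j.castSucc) (fun j => h j.castSucc) f) := by
  rw [downSteps, List.ofFn_succ, List.foldr_cons, Fin.rev_zero]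
  simp only [Fin.rev_succ]
  rfl

theorem downSteps_bot (t : ℝ) {N : ℕ} (b : Fin N → ℝ) (h : Fin N → Bool)
    (f : YoungDiagram → ENNReal) :
    downSteps t b h f ⊥ = if (fun _ => true) = h then f ⊥ else 0 := by
  induction N with
  | zero => rw [if_pos (Subsingleton.elim _ _)]; rfl
  | succ N ih =>
    rw [downSteps_succ, applyKernel_downKernel_bot, ih, ← ite_and]
    congr 1
    simp only [funext_iff, Fin.forall_fin_succ', eq_iff_iff]
    exact and_comm

/-- One ascending step passes all descending steps and creates one column of vertices, with right
edges `h` and left edges `h'`. It meets the descending step of largest index first, so it travels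
from the top edge `v` down to the bottom edge, which is `false` because the step then ends at `⊥`.
-/
theorem applyKernel_upKernel_downSteps {t a : ℝ} (ht0 : 0 ≤ t) (ht1 : t ≤ 1) (ha : 0 ≤ a) {N : ℕ}
    {b : Fin N → ℝ} (hb : ∀ y, 0 ≤ b y) (hab : ∀ y, a * b y < 1) (h : Fin N → Bool) (v : Bool)
    (x : YoungDiagram) :
    applyKernel (upKernel t a v) (downSteps t b h botIndicator) x =
      ∑ h' : Fin N → Bool, transferSum (fun y d u =>
        ENNReal.ofReal (exchCoef t (a * b y) (h' y) d (h y) u)) false v *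
          downSteps t b h' botIndicator x := by
  induction N generalizing v x with
  | zero =>
    simp only [transferSum_zero, Fintype.sum_unique]
    simp only [downSteps, List.ofFn_zero, List.foldr_nil]
    rw [applyKernel_botIndicator, upKernel_bot]
    simp
  | succ N ih =>
    rw [downSteps_succ, applyKernel_upKernel_downKernel ht0 ht1 ha (hb _) (hab _)]
    have ih' (v2 : Bool) := funext fun z => ih (fun y => hb y.castSucc) (fun y => hab y.castSucc)
      (fun y => h y.castSucc) v2 z
    simp only [ih', applyKernel_sum]
    rw [← (Fin.snocEquiv fun _ : Fin (N + 1) => Bool).sum_comp, Fintype.sum_prod_type]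
    refine Finset.sum_congr rfl fun h2 _ => ?_
    simp only [Finset.mul_sum]
    rw [Finset.sum_comm]
    refine Finset.sum_congr rfl fun h' _ => ?_
    rw [transferSum_succ, Finset.sum_mul, downSteps_succ]
    refine Finset.sum_congr rfl fun v2 _ => ?_
    simp only [Fin.snocEquiv_apply, Fin.snoc_last, Fin.snoc_castSucc]
    ring

/-- The last ascending step is adjacent to the descending ones and crosses first, which gives the
rightmost column of the lattice; the left edges of this column are the right edges for the remaining
steps. -/
theorem upSteps_downSteps_bot {t : ℝ} (ht0 : 0 ≤ t) (ht1 : t ≤ 1) {M N : ℕ}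
    {a : Fin M → ℝ} {b : Fin N → ℝ} (ha : ∀ x, 0 ≤ a x) (hb : ∀ y, 0 ≤ b y)
    (hab : ∀ x y, a x * b y < 1) (v : Fin M → Bool) (h : Fin N → Bool) :
    upSteps t a v (downSteps t b h botIndicator) ⊥ =
      transferSum (fun x (l r : Fin N → Bool) => transferSum (fun y d u =>
        ENNReal.ofReal (exchCoef t (a x * b y) (l y) d (r y) u)) false (v x)) (fun _ => true) h := by
  induction M generalizing h with
  | zero =>
    rw [transferSum_zero, upSteps, List.ofFn_zero, List.foldr_nil, downSteps_bot]
    simp [botIndicator]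
  | succ M ih =>
    have e := funext fun z =>
      applyKernel_upKernel_downSteps ht0 ht1 (ha (Fin.last M)) hb (hab (Fin.last M)) h
        (v (Fin.last M)) z
    rw [upSteps_succ, e, transferSum_succ, upSteps, foldr_applyKernel_sum]
    refine Finset.sum_congr rfl fun h' _ => ?_
    rw [← ih (fun x => ha x.castSucc) (fun x => hab x.castSucc), mul_comm]
    rfl

/-! ### The Hall--Littlewood process as a composition of kernels -/

/-- The sum over intermediate diagrams of a path that ends at `⊥` is an iterated kernel action. The
starting point `x` is arbitrary so that induction can remove the first step. -/
theorem tsum_prod_cons_snoc {n : ℕ} (K : Fin (n + 1) → YoungDiagram → YoungDiagram → ENNReal)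
    (x : YoungDiagram) :
    ∑' p : Fin n → YoungDiagram, ∏ i : Fin (n + 1),
      K i ((Fin.cons x (Fin.snoc p ⊥ : Fin (n + 1) → YoungDiagram) : Fin (n + 2) → YoungDiagram)
        i.castSucc)
        ((Fin.snoc p ⊥ : Fin (n + 1) → YoungDiagram) i) =
      (List.ofFn K).foldr applyKernel botIndicator x := by
  induction n generalizing x with
  | zero =>
    rw [List.ofFn_succ, List.ofFn_zero, List.foldr_cons, List.foldr_nil, applyKernel_botIndicator,
      tsum_eq_single default fun p hp => absurd (Subsingleton.elim p default) hp]
    simp [Fin.snoc]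
  | succ n ih =>
    rw [List.ofFn_succ, List.foldr_cons, applyKernel,
      ← (Fin.consEquiv fun _ : Fin (n + 1) => YoungDiagram).tsum_eq, ENNReal.tsum_prod']
    refine tsum_congr fun y => ?_
    rw [← ih (fun i => K i.succ) y, ← ENNReal.tsum_mul_left]
    refine tsum_congr fun p => ?_
    have e : (Fin.snoc ((Fin.consEquiv fun _ : Fin (n + 1) => YoungDiagram) (y, p)) ⊥ :
        Fin (n + 2) → YoungDiagram) = Fin.cons y (Fin.snoc p ⊥ : Fin (n + 1) → YoungDiagram) :=
      (Fin.cons_snoc_eq_snoc_cons _ _ _).symm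
    rw [Fin.prod_univ_succ]
    rw [e]
    simp only [Fin.cons_zero, Fin.castSucc_zero, ← Fin.succ_castSucc, Fin.cons_succ]

/-- The entry with index `k` of a sequence of `n - 1` diagrams, extended by empty diagrams. -/
def seqAt {n : ℕ} (p : Fin (n - 1) → YoungDiagram) (k : ℕ) : YoungDiagram :=
  if h : 1 ≤ k ∧ k < n then p ⟨k - 1, by omega⟩ else ⊥

theorem tsum_prod_seqAt {n : ℕ} (hn : 0 < n)
    (K : Fin n → YoungDiagram → YoungDiagram → ENNReal) :
    ∑' p : Fin (n - 1) → YoungDiagram, ∏ i : Fin n, K i (seqAt p i) (seqAt p (i + 1)) =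
      (List.ofFn K).foldr applyKernel botIndicator ⊥ := by
  obtain _ | n := n
  · omega
  rw [← tsum_prod_cons_snoc]
  refine tsum_congr fun p => Finset.prod_congr rfl fun i _ => ?_
  congr 1
  · refine Fin.cases ?_ (fun j => ?_) i
    · simp [seqAt]
    · rw [Fin.castSucc_succ, Fin.cons_succ, Fin.snoc_castSucc, seqAt, dif_pos (by simp)]
      rfl
  · refine Fin.lastCases ?_ (fun j => ?_) i
    · simp [seqAt]
    · rw [Fin.snoc_castSucc, seqAt, dif_pos (by simp)]
      rfl

theorem tsum_prod_at {M N : ℕ} (hMN : 0 < M + N)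
    (K : Fin (M + N) → YoungDiagram → YoungDiagram → ENNReal) :
    ∑' lam : PartitionSeq M N, ∏ i : Fin (M + N), K i (lam.at i) (lam.at (i + 1)) =
      (List.ofFn K).foldr applyKernel botIndicator ⊥ :=
  tsum_prod_seqAt hMN K

theorem append_eq_append_iff {M N : ℕ} {f f' : Fin M → Bool} {g g' : Fin N → Bool} :
    Fin.append f g = Fin.append f' g' ↔ (∀ i, f i = f' i) ∧ ∀ j, g j = g' j := by
  constructor
  · intro h
    exact ⟨fun i => by simpa using congrFun h (Fin.castAdd N i),
      fun j => by simpa using congrFun h (Fin.natAdd M j)⟩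
  · rintro ⟨h1, h2⟩
    rw [funext h1, funext h2]

/-- The sign string of the occupation numbers `v` of the top edges and `h` of the right edges. -/
def signString {M N : ℕ} (v : Fin M → Bool) (h : Fin N → Bool) : Fin (M + N) → Bool :=
  Fin.append (fun i => !v i) (fun j => !h j.rev)

theorem exists_signString_eq {M N : ℕ} (T : Fin (M + N) → Bool) :
    ∃ (v : Fin M → Bool) (h : Fin N → Bool), signString v h = T :=
  ⟨fun i => !T (Fin.castAdd N i), fun j => !T (Fin.natAdd M j.rev), by
    rw [signString]
    simp only [Bool.not_not, Fin.rev_rev]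
    exact Fin.append_castAdd_natAdd⟩

/-- The probability of a sequence without the normalization. -/
noncomputable def processWeight {M N : ℕ} (t : ℝ) (a : Fin M → ℝ) (b : Fin N → ℝ)
    (lam : PartitionSeq M N) : ℝ :=
  (∏ i : Fin M, skewP t (lam.at (i + 1)) (lam.at i) (a i)) *
    ∏ j : Fin N, skewQ t (lam.at (M + j)) (lam.at (M + j + 1)) (b j.rev)

section

variable {M N : ℕ} {t : ℝ} {a : Fin M → ℝ} {b : Fin N → ℝ}

theorem processWeight_nonneg (ht0 : 0 ≤ t) (ht1 : t ≤ 1) (ha : ∀ x, 0 ≤ a x) (hb : ∀ y, 0 ≤ b y)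
    (lam : PartitionSeq M N) : 0 ≤ processWeight t a b lam :=
  mul_nonneg (Finset.prod_nonneg fun _ _ => skewP_nonneg ht0 ht1 (ha _) _ _)
    (Finset.prod_nonneg fun _ _ => skewQ_nonneg ht0 ht1 (hb _) _ _)

theorem tsum_ofReal_processWeight (hMN : 0 < M + N) (ht0 : 0 ≤ t) (ht1 : t ≤ 1)
    (ha : ∀ x, 0 ≤ a x) (hb : ∀ y, 0 ≤ b y) (v : Fin M → Bool) (h : Fin N → Bool) :
    ∑' lam : PartitionSeq M N,
        ENNReal.ofReal (if supportString lam = signString v h then processWeight t a b lam else 0) =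
      upSteps t a v (downSteps t b h botIndicator) ⊥ := by
  have e : upSteps t a v (downSteps t b h botIndicator) =
      (List.ofFn (Fin.append (fun i : Fin M => upKernel t (a i) (v i))
        (fun j : Fin N => downKernel t (b j.rev) (h j.rev)))).foldr applyKernel botIndicator := by
    rw [List.ofFn_fin_append, List.foldr_append]
    rfl
  rw [e, ← tsum_prod_at hMN]
  refine tsum_congr fun lam => ?_
  rw [Fin.prod_univ_add]
  simp only [Fin.append_left, Fin.append_right, Fin.val_castAdd, Fin.val_natAdd, upKernel,
    downKernel, Finset.prod_ite_zero, Finset.mem_univ, true_imp_iff, supportString, signString,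
    append_eq_append_iff, ite_and, processWeight]
  rw [← ENNReal.ofReal_prod_of_nonneg fun _ _ => skewP_nonneg ht0 ht1 (ha _) _ _,
    ← ENNReal.ofReal_prod_of_nonneg fun _ _ => skewQ_nonneg ht0 ht1 (hb _) _ _]
  split_ifs
  · rw [ENNReal.ofReal_mul (Finset.prod_nonneg fun _ _ => skewP_nonneg ht0 ht1 (ha _) _ _)]
  all_goals simp

end

/-! ### The six vertex model as a transfer sum -/

theorem vertexWeight_mul {t z w : ℝ} (ht0 : 0 < t) (hw : w * (√t * z) = 1)
    (htw : t * w ≠ 1) (hw1 : w ≠ 1) (l d r u : Bool) :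
    (1 - t * w) / (1 - w) * vertexWeight t z l d r u = exchCoef t w l d r u := by
  have hw0 : w ≠ 0 := left_ne_zero_of_mul_eq_one hw
  -- In terms of `s = √t` and `w` all weights become rational functions.
  obtain ⟨s, hs, rfl⟩ : ∃ s, 0 < s ∧ s ^ 2 = t :=
    ⟨√t, Real.sqrt_pos.2 ht0, Real.sq_sqrt ht0.le⟩
  rw [Real.sqrt_sq hs.le] at hw
  obtain rfl : z = 1 / (s * w) := by
    rw [eq_div_iff (by positivity)]
    linarith
  have h1 : 1 - s ^ 2 * w ≠ 0 := sub_ne_zero.2 htw.symm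
  have h2 : 1 - w ≠ 0 := sub_ne_zero.2 hw1.symm
  have h3 : 1 - 1 / s * (1 / (s * w)) = -(1 - s ^ 2 * w) / (s ^ 2 * w) := by
    field_simp
    ring
  cases l <;> cases d <;> cases r <;> cases u <;>
    simp only [vertexWeight, exchCoef, mul_zero, mul_one, Real.sqrt_sq hs.le, h3] <;>
    field_simp <;> ring

/-- A path of the outer transfer sum lists the horizontal edges from left to right, and the inner
paths list the vertical edges in each column. Fixed endpoints encode the boundary condition and the
outgoing edges. Nonnegativity of `C` allows `ENNReal.ofReal` to pass through the sums and products.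
-/
theorem transferSum_eq_sum_edgeConfig {M N : ℕ} {Z : Fin M → Fin N → ℝ} {Q : ℝ}
    {ξ : Fin M → ℝ} {u : Fin N → ℝ} {C : Fin M → Fin N → Bool → Bool → Bool → Bool → ℝ}
    (hC : ∀ x y l d r w, Z x y * vertexWeight Q (ξ x * u y) l d r w = C x y l d r w)
    (hC0 : ∀ x y l d r w, 0 ≤ C x y l d r w) (v : Fin M → Bool) (h : Fin N → Bool) :
    transferSum (fun x (l r : Fin N → Bool) => transferSum (fun y d w =>
        ENNReal.ofReal (C x y (l y) d (r y) w)) false (v x)) (fun _ => true) h =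
      ENNReal.ofReal ((∏ x, ∏ y, Z x y) *
        ∑ σ : EdgeConfig M N, if σ.outgoing = signString v h then σ.prob Q ξ u else 0) := by
  have hprod (σ : EdgeConfig M N) : 0 ≤ ∏ x : Fin M, ∏ y : Fin N, C x y
      (σ.horiz x.castSucc y) (σ.vert x y.castSucc) (σ.horiz x.succ y) (σ.vert x y.succ) :=
    Finset.prod_nonneg fun x _ => Finset.prod_nonneg fun y _ => hC0 _ _ _ _ _ _
  have hσ (σ : EdgeConfig M N) : (∏ x, ∏ y, Z x y) *
      (if σ.outgoing = signString v h then σ.prob Q ξ u else 0) =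
      if ((fun y => σ.horiz 0 y) = fun _ => true) ∧ (fun y => σ.horiz (Fin.last M) y) = h then
        if ∀ x, σ.vert x 0 = false ∧ σ.vert x (Fin.last N) = v x then
          ∏ x : Fin M, ∏ y : Fin N, C x y (σ.horiz x.castSucc y) (σ.vert x y.castSucc)
            (σ.horiz x.succ y) (σ.vert x y.succ) else 0 else 0 := by
    have e : σ.outgoing = signString v h ↔
        (∀ x, σ.vert x (Fin.last N) = v x) ∧ ∀ y, σ.horiz (Fin.last M) y = h y := by
      rw [EdgeConfig.outgoing, signString, append_eq_append_iff]
      simp only [Bool.not_inj_iff]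
      rw [(Fin.revPerm (n := N)).forall_congr_left (p := fun y => σ.horiz (Fin.last M) y.rev = h y.rev)]
      simp
    have hB : σ.Boundary ↔ (∀ y, σ.horiz 0 y = true) ∧ ∀ x, σ.vert x 0 = false := Iff.rfl
    simp only [← hC, Finset.prod_mul_distrib, e, EdgeConfig.prob, hB, funext_iff,
      forall_and, ← ite_and, mul_ite, mul_zero]
    split_ifs <;> first | rfl | (exfalso; tauto)
  rw [Finset.mul_sum, ENNReal.ofReal_sum_of_nonneg]
  · simp only [hσ]
    rw [← (EdgeConfig.equiv M N).sum_comp, Fintype.sum_prod_type, transferSum]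
    refine Finset.sum_congr rfl fun p _ => ?_
    simp only [transferSum, Finset.prod_univ_sum, Fintype.piFinset_univ, Finset.prod_ite_zero,
      Finset.mem_univ, true_imp_iff]
    split_ifs with hp
    · refine Finset.sum_congr rfl fun q _ => ?_
      have e : ∀ x : Fin M, ∏ y : Fin N, ENNReal.ofReal (C x y (p x.castSucc y) (q x y.castSucc)
          (p x.succ y) (q x y.succ)) = ENNReal.ofReal (∏ y : Fin N,
            C x y (p x.castSucc y) (q x y.castSucc) (p x.succ y) (q x y.succ)) := fun x =>
        (ENNReal.ofReal_prod_of_nonneg fun _ _ => hC0 _ _ _ _ _ _).symm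
      simp only [e]
      rw [← ENNReal.ofReal_prod_of_nonneg fun _ _ => Finset.prod_nonneg fun _ _ => hC0 _ _ _ _ _ _]
      rw [apply_ite ENNReal.ofReal, apply_ite ENNReal.ofReal, ENNReal.ofReal_zero]
      exact (if_pos hp).symm
    · symm
      refine Finset.sum_eq_zero fun q _ => ?_
      rw [apply_ite ENNReal.ofReal, ENNReal.ofReal_zero]
      exact if_neg hp
  · intro σ _
    rw [hσ]
    split_ifs
    exacts [hprod σ, le_rfl, le_rfl]

/-- The theorem refined to a single sign string. It needs only `a x * b y = 1 / (√t * (ξ x * u y))`,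
which is what the matching of parameters amounts to. -/
theorem hasSum_processProb {M N : ℕ} (hMN : 0 < M + N) {t : ℝ} {a ξ : Fin M → ℝ}
    {b u : Fin N → ℝ} (ht0 : 0 < t) (ht1 : t < 1) (ha : ∀ x, 0 < a x) (hb : ∀ y, 0 < b y)
    (hab : ∀ x y, a x * b y < 1) (hz : ∀ x y, a x * b y * (√t * (ξ x * u y)) = 1)
    (T : Fin (M + N) → Bool) :
    HasSum (fun lam : PartitionSeq M N => if supportString lam = T then processProb t a b lam else 0)
      (∑ σ : EdgeConfig M N, if σ.outgoing = T then σ.prob t ξ u else 0) := by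
  obtain ⟨v, h, rfl⟩ := exists_signString_eq T
  have hw0 (x : Fin M) (y : Fin N) : 0 ≤ a x * b y := mul_nonneg (ha x).le (hb y).le
  have htw (x : Fin M) (y : Fin N) : t * (a x * b y) < 1 :=
    (mul_le_of_le_one_left (hw0 x y) ht1.le).trans_lt (hab x y)
  have hZ : 0 < ∏ x : Fin M, ∏ y : Fin N, (1 - t * (a x * b y)) / (1 - a x * b y) :=
    Finset.prod_pos fun x _ => Finset.prod_pos fun y _ =>
      div_pos (sub_pos.2 (htw x y)) (sub_pos.2 (hab x y))
  have hs := tsum_ofReal_processWeight hMN ht0.le ht1.le (fun x => (ha x).le) (fun y => (hb y).le) v h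
  rw [upSteps_downSteps_bot ht0.le ht1.le (fun x => (ha x).le) (fun y => (hb y).le) hab,
    transferSum_eq_sum_edgeConfig
      (fun x y => vertexWeight_mul ht0 (hz x y) (htw x y).ne (hab x y).ne)
      (fun x y => exchCoef_nonneg ht0.le ht1.le (hw0 x y) (hab x y).le)] at hs
  have hσ : 0 ≤ ∑ σ : EdgeConfig M N,
      if σ.outgoing = signString v h then σ.prob t ξ u else 0 := by
    refine Finset.sum_nonneg fun σ _ => ?_
    rw [EdgeConfig.prob]
    split_ifs
    · refine Finset.prod_nonneg fun x _ => Finset.prod_nonneg fun y _ => ?_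
      -- The vertex weight is nonnegative because its product with a positive normalization is an
      -- exchange coefficient.
      refine nonneg_of_mul_nonneg_right (?_ : 0 ≤ (1 - t * (a x * b y)) / (1 - a x * b y) * _)
        (div_pos (sub_pos.2 (htw x y)) (sub_pos.2 (hab x y)))
      rw [vertexWeight_mul ht0 (hz x y) (htw x y).ne (hab x y).ne]
      exact exchCoef_nonneg ht0.le ht1.le (hw0 x y) (hab x y).le _ _ _ _
    all_goals exact le_rfl
  -- The total in `ENNReal` is finite, which gives convergence of the real series.
  have hsum := ENNReal.hasSum_toReal (hs.trans_ne ENNReal.ofReal_ne_top)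
  rw [← ENNReal.tsum_toReal_eq fun _ => ENNReal.ofReal_ne_top, hs, ENNReal.toReal_ofReal (mul_nonneg hZ.le hσ)] at hsum
  convert! hsum.div_const _ using 1
  · funext lam
    rw [ENNReal.toReal_ofReal]
    · rw [processProb, processWeight, ite_div, zero_div]
    · split_ifs
      exacts [processWeight_nonneg ht0.le ht1.le (fun x => (ha x).le) (fun y => (hb y).le) lam,
        le_rfl]
  · simp only [mul_assoc]
    rw [mul_div_cancel_left₀ _ hZ.ne']

end HLSixVertex

theorem mainTheorem4 (M N : ℕ) (hM : 0 < M) (hN : 0 < N)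
    (t Q : ℝ) (a ξ : Fin M → ℝ) (b u : Fin N → ℝ)
    (ht0 : 0 < t) (ht1 : t < 1)
    (ha : ∀ x, 0 < a x) (hb : ∀ y, 0 < b y) (hab : ∀ x y, a x * b y < 1)
    (hQ0 : 0 < Q) (hQ1 : Q < 1)
    (hξ : ∀ x, 0 < ξ x) (hu : ∀ y, 0 < u y) (hξu : ∀ x y, 1 / √Q < ξ x * u y)
    (htQ : t = Q) (haξ : ∀ x, a x = √t / ξ x) (hbu : ∀ y, b y = 1 / (t * u y))
    (ν : YoungDiagram) (hνM : ν.colLen 0 ≤ M) (hνN : ν.rowLen 0 ≤ N) :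
    Summable (HLSixVertex.supportTerm t a b ν) ∧
      HLSixVertex.supportProb t a b ν = HLSixVertex.outgoingProb Q ξ u ν := by
  classical
  subst htQ
  have hz (x : Fin M) (y : Fin N) : a x * b y * (√t * (ξ x * u y)) = 1 := by
    rw [haξ, hbu]
    have h1 := (hξ x).ne'
    have h2 := (hu y).ne'
    have h3 := Real.mul_self_sqrt ht0.le
    field_simp
    rw [sq, h3]
  have key : HasSum (HLSixVertex.supportTerm t a b ν) (HLSixVertex.outgoingProb t ξ u ν) := by
    -- Both sides are sums of the refined identity over the finitely many strings with partition
    -- `ν`, so injectivity of `partitionOfString` is not needed.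
    have h := hasSum_sum (s := Finset.univ.filter fun T : Fin (M + N) → Bool =>
      HLSixVertex.partitionOfString T = ν)
      fun T _ => HLSixVertex.hasSum_processProb (Nat.add_pos_left hM N) ht0 ht1 ha hb hab hz T
    convert! h using 1
    · funext lam
      rw [HLSixVertex.supportTerm, Finset.sum_ite_eq]
      simp only [Finset.mem_filter, Finset.mem_univ, true_and, HLSixVertex.support]
      congr
    · rw [Finset.sum_comm, HLSixVertex.outgoingProb]
      refine Finset.sum_congr rfl fun σ _ => ?_
      rw [Finset.sum_ite_eq]
      simp
  exact ⟨key.summable, key.tsum_eq⟩
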